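/- For a matrix $A\in\mathbb R^{d\times d}$ let $\|A\|_F=\sqrt{\mathrm{tr}(A^\top A)}$, and for positive definite $\Sigma$ let $\|A\|_\Sigma=\|\Sigma^{-1/2}A\Sigma^{-1/2}\|_F$ (Mahalanobis norm). A randomized algorithm $M$ that maps datasets in $(\mathbb R^d)^n$ to matrices in $\mathbb R^{d\times d}$ (a Markov kernel) is $(\varepsilon,\delta)$-DP if $\Pr[M(X)\in S]\le e^{\varepsilon}\Pr[M(X')\in S]+\delta$ for all $X,X'$ that differ in exactly one of the $n$ entries and all measurable $S$. **Theorem 4.1.** There are absolute constants $c_1,c_2,c_3>0$ such that for every $d\ge 1$ there is a probability distribution $\mathcal D$ on $\mathbb R^{d\times d}$ with $\mathbb I\preceq\Sigma\preceq 2\mathbb I$ for $\mathcal D$-almost every $\Sigma$ and with the following property. Let $n\in\mathbb N$, $0\le\alpha\le c_1$, $\varepsilon,\delta\in[0,1]$ with $$\delta\le c_2\min\Big\{\frac1n,\ \frac{d^2}{n\,\max\{1,\log(n/d^2)\}}\Big\},$$ where the right-hand side is read as $0$ for $n=0$, and let $M$ be an $(\varepsilon,\delta)$-DP algorithm that, for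 $\Sigma\sim\mathcal D$ and $X\sim\mathcal N(0,\Sigma)^{\otimes n}$ given $\Sigma$, satisfies $$\mathbb E_{\Sigma,X,M}\big[\|M(X)-\Sigma\|_\Sigma^2\big]\le\alpha^2\qquad\text{or}\qquad \mathbb E_{\Sigma,X,M}\big[\|M(X)-\Sigma\|_F^2\big]\le\alpha^2 .$$ Then $n\,\alpha\,\varepsilon\ge c_3\,d^2$, i.e. $n\ge c_3\,d^2/(\alpha\varepsilon)$ (and no such $M$ exists if $\alpha\varepsilon=0$). -/

import Mathlib

open MeasureTheory ProbabilityTheory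
open scoped MatrixOrder

/-- The Borel (= product) sigma-algebra on real matrices, coordinatewise. -/
instance matrixMeasurableSpace {m n : Type*} : MeasurableSpace (Matrix m n ℝ) :=
  inferInstanceAs (MeasurableSpace (m → n → ℝ))

/-- Two datasets are neighbouring if they differ in exactly one entry. -/
def Neighboring {𝒳 : Type*} {n : ℕ} (X X' : Fin n → 𝒳) : Prop :=
  ∃ i, X i ≠ X' i ∧ ∀ j, j ≠ i → X j = X' j

/-- A randomized algorithm with `n` samples, i.e. a Markov kernel `M` from datasets to outputs
(`M X S` is the probability that the output on `X` lies in `S`), is `(ε, δ)`-differentially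
private. -/
def IsDP {𝒳 𝒴 : Type*} [MeasurableSpace 𝒳] [MeasurableSpace 𝒴] {n : ℕ} (ε δ : ℝ)
    (M : Kernel (Fin n → 𝒳) 𝒴) : Prop :=
  ∀ X X' : Fin n → 𝒳, Neighboring X X' → ∀ S : Set 𝒴, MeasurableSet S →
    M X S ≤ ENNReal.ofReal (Real.exp ε) * M X' S + ENNReal.ofReal δ

/-- The Frobenius norm `√(tr(AᵀA))`. -/
noncomputable def frobNorm {d : ℕ} (A : Matrix (Fin d) (Fin d) ℝ) : ℝ :=
  Real.sqrt (A.transpose * A).trace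

/-- The Mahalanobis norm `‖Σ^{-1/2} A Σ^{-1/2}‖_F` of `A` with respect to a positive definite
matrix `Σ`. -/
noncomputable def mahaNorm {d : ℕ} (Sig A : Matrix (Fin d) (Fin d) ℝ) : ℝ :=
  frobNorm ((CFC.sqrt Sig)⁻¹ * A * (CFC.sqrt Sig)⁻¹)

/-- The expected squared error `E[‖M(X) - Σ‖²]` in `[0, ∞]`, where `Σ ∼ D`,
`X ∼ N(0, Σ)^{⊗ n}` given `Σ`, and the expectation is over `Σ`, `X` and the randomness of `M`;
the error is measured by the norm `ν Σ`, which may depend on `Σ`. -/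
noncomputable def expectedSqError {d n : ℕ}
    (ν : Matrix (Fin d) (Fin d) ℝ → Matrix (Fin d) (Fin d) ℝ → ℝ)
    (D : Measure (Matrix (Fin d) (Fin d) ℝ))
    (M : Kernel (Fin n → EuclideanSpace ℝ (Fin d)) (Matrix (Fin d) (Fin d) ℝ)) : ENNReal :=
  ∫⁻ Sig, ∫⁻ X, ∫⁻ A, ENNReal.ofReal (ν Sig (A - Sig) ^ 2) ∂(M X)
    ∂(Measure.pi fun _ : Fin n => multivariateGaussian 0 Sig) ∂D

/-! This is a fingerprinting (score attack) argument. Put independent uniform parameters `θ j` on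
`[-1, 1]` in the covariance and let `φ` be the part of the output that estimates `τ θ`. Integration
by parts against the weight `1 - θ j ^ 2`, which vanishes at the endpoints, shows that `∑ j, (1 - θ
j ^ 2) * ∂_j E[φ j]` and `∑ j, 2 * θ j * E[φ j]` have the same mean over the prior. If `φ` is
accurate, the second sum is about `∑ j, 2 * θ j * τ θ j`, which is large. In the first sum `∂_j E[φ
j]` is the sum over the samples of the correlation of `φ j` with the score of that sample. Replacing
the sample by a fresh copy makes output and score independent, so the correlation becomes zero;
privacy says that the replacement changes little. Each sample therefore contributes at most about `2
* ε * σ * (mean error)` plus a `δ` term, and many samples are needed (`integral_inner_score_le`,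
`ScoreModel.fingerprinting_bound`).

For `d = k + l ≥ 2` the family is linear regression: Gaussian covariates in `ℝ^k`, and responses in
`ℝ^l` with coefficients `ρ * θ (i, j)`. The parameters appear, scaled, in an off-diagonal block of
the covariance. With `N = √(k * l)` and `ρ = 1 / (4 * N)` the coefficient matrix has Frobenius norm
at most `1 / 4`, which keeps the covariance between `1` and `2`. The score is `ρ` times a random
matrix with uncorrelated entries of unit variance, so `σ = ρ`. Accuracy gives order `N`, privacy
allows order `n * ε * ρ * β`, and hence `n * ε * β` is of order `N ^ 2`, that is `d ^ 2`. Truncating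
the output to a ball of constant radius keeps the `δ` term at order `n * δ`. For `d = 1` there is no
off-diagonal entry, and a scale family is used instead. Mahalanobis accuracy reduces to Frobenius
accuracy because `Σ ≤ 2`. -/

/-! ### Exchange of samples, product densities, and privacy for integrals -/

/-- Exchanging one coordinate of an i.i.d. family with an independent copy preserves the law. -/
lemma measurePreserving_exchange {ι 𝒳 : Type*} [Fintype ι] [DecidableEq ι] [MeasurableSpace 𝒳]
    (P : Measure 𝒳) [IsProbabilityMeasure P] (i : ι) :
    MeasurePreserving (fun q : (ι → 𝒳) × 𝒳 => (Function.update q.1 i q.2, q.1 i))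
      ((Measure.pi fun _ : ι => P).prod P) ((Measure.pi fun _ : ι => P).prod P) := by
  have hm : Measurable (fun q : (ι → 𝒳) × 𝒳 => (Function.update q.1 i q.2, q.1 i)) := by
    refine Measurable.prodMk ?_ ((measurable_pi_apply i).comp measurable_fst)
    refine measurable_pi_lambda _ fun j => ?_
    by_cases h : j = i
    · subst h; simpa using measurable_snd
    · simp only [Function.update_of_ne h]
      exact (measurable_pi_apply j).comp measurable_fst
  refine ⟨hm, ?_⟩
  symm
  let C : Set (Set (ι → 𝒳)) := Set.pi Set.univ '' Set.pi Set.univ fun _ => {s | MeasurableSet s}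
  have hspan : (Measure.pi fun _ : ι => P).FiniteSpanningSetsIn C :=
    { set := fun _ => Set.univ
      set_mem := fun _ => ⟨fun _ => Set.univ, fun _ _ => MeasurableSet.univ, Set.pi_univ _⟩
      finite := fun _ => measure_lt_top _ _
      spanning := Set.iUnion_const _ }
  refine Measure.prod_eq_generateFrom (C := C) generateFrom_pi
    (MeasurableSpace.generateFrom_measurableSet) isPiSystem_pi
    (MeasurableSpace.isPiSystem_measurableSet) hspan P.toFiniteSpanningSetsIn ?_
  rintro _ ⟨s, hs, rfl⟩ t ht
  have hs' : ∀ j, MeasurableSet (s j) := fun j => hs j (Set.mem_univ j)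
  rw [Measure.map_apply hm ((MeasurableSet.univ_pi hs').prod ht)]
  -- On boxes the exchange swaps the factors `s i` and `t`, and the product of the measures does not
  -- change.
  have : (fun q : (ι → 𝒳) × 𝒳 => (Function.update q.1 i q.2, q.1 i)) ⁻¹' (Set.pi Set.univ s ×ˢ t)
      = Set.pi Set.univ (Function.update s i t) ×ˢ s i := by
    ext ⟨X, x⟩
    simp only [Set.mem_preimage, Set.mem_prod, Set.mem_pi, Set.mem_univ, true_implies]
    constructor
    · rintro ⟨h1, h2⟩
      refine ⟨fun j => ?_, by simpa using h1 i⟩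
      by_cases h : j = i
      · subst h; simpa using h2
      · simpa [Function.update_of_ne h] using h1 j
    · rintro ⟨h1, h2⟩
      refine ⟨fun j => ?_, by simpa using h1 i⟩
      by_cases h : j = i
      · subst h; simpa using h2
      · simpa [Function.update_of_ne h] using h1 j
  rw [this, Measure.prod_prod, Measure.pi_pi, Measure.pi_pi,
    ← Finset.mul_prod_erase _ _ (Finset.mem_univ i),
    ← Finset.mul_prod_erase _ (fun j => P (s j)) (Finset.mem_univ i), Function.update_self]
  have : ∏ j ∈ Finset.univ.erase i, P (Function.update s i t j)
      = ∏ j ∈ Finset.univ.erase i, P (s j) :=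
    Finset.prod_congr rfl fun j hj => by rw [Function.update_of_ne (Finset.ne_of_mem_erase hj)]
  rw [this]; ring

/-- A product of measures with a density has the product density. -/
lemma pi_withDensity_ofReal {ι 𝒳 : Type*} [Fintype ι] [MeasurableSpace 𝒳]
    (Q : Measure 𝒳) [SigmaFinite Q] (p : 𝒳 → ℝ) (hp0 : ∀ x, 0 ≤ p x) (hp : Integrable p Q) :
    Measure.pi (fun _ : ι => Q.withDensity fun x => ENNReal.ofReal (p x))
      = (Measure.pi fun _ : ι => Q).withDensity fun X => ENNReal.ofReal (∏ i, p (X i)) := by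
  have : IsFiniteMeasure (Q.withDensity fun x => ENNReal.ofReal (p x)) :=
    isFiniteMeasure_withDensity_ofReal hp.2
  refine Measure.pi_eq fun s hs => ?_
  rw [withDensity_apply _ (MeasurableSet.univ_pi hs), Measure.restrict_pi_pi,
    ← ofReal_integral_eq_lintegral_ofReal (Integrable.fintype_prod fun i => hp.restrict)
      (Filter.Eventually.of_forall fun X => Finset.prod_nonneg fun i _ => hp0 _),
    integral_fintype_prod_eq_prod (fun _ => p),
    ENNReal.ofReal_prod_of_nonneg fun i _ => integral_nonneg hp0]
  refine Finset.prod_congr rfl fun i _ => ?_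
  rw [withDensity_apply _ (hs i), ofReal_integral_eq_lintegral_ofReal hp.restrict
    (Filter.Eventually.of_forall hp0)]

/-- Approximate max-divergence bounds on events pass to bounded nonnegative functions. -/
lemma integral_le_of_forall_measure_le {𝒴 : Type*} [MeasurableSpace 𝒴] {μ ν : Measure 𝒴}
    [IsProbabilityMeasure μ] [IsProbabilityMeasure ν] {a b K : ℝ} (ha : 0 ≤ a) (hb : 0 ≤ b)
    (h : ∀ S, MeasurableSet S → μ S ≤ ENNReal.ofReal a * ν S + ENNReal.ofReal b)
    {f : 𝒴 → ℝ} (hf : Measurable f) (hf0 : ∀ y, 0 ≤ f y) (hfK : ∀ y, f y ≤ K) :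
    ∫ y, f y ∂μ ≤ a * ∫ y, f y ∂ν + b * K := by
  have hK : 0 ≤ K := by
    obtain ⟨y⟩ := nonempty_of_isProbabilityMeasure μ
    exact (hf0 y).trans (hfK y)
  have hint : ∀ (ρ : Measure 𝒴) [IsProbabilityMeasure ρ], Integrable f ρ := fun ρ _ =>
    Integrable.of_bound hf.aestronglyMeasurable K (Filter.Eventually.of_forall fun y => by
      rw [Real.norm_of_nonneg (hf0 y)]; exact hfK y)
  have key : ∫⁻ y, ENNReal.ofReal (f y) ∂μ
      ≤ ENNReal.ofReal a * ∫⁻ y, ENNReal.ofReal (f y) ∂ν + ENNReal.ofReal b * ENNReal.ofReal K := by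
    -- Layer cake: apply the event bound to every superlevel set. Levels above `K` are empty, so the
    -- additive error is paid only on `(0, K)`.
    rw [lintegral_eq_lintegral_meas_lt μ (Filter.Eventually.of_forall hf0) hf.aemeasurable,
      lintegral_eq_lintegral_meas_lt ν (Filter.Eventually.of_forall hf0) hf.aemeasurable]
    have hmeas : Measurable fun t : ℝ => ν {y | t < f y} :=
      Antitone.measurable fun s t hst => measure_mono fun y hy => lt_of_le_of_lt hst hy
    calc ∫⁻ t in Set.Ioi 0, μ {y | t < f y}
        ≤ ∫⁻ t in Set.Ioi 0, (ENNReal.ofReal a * ν {y | t < f y}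
            + (Set.Ioo 0 K).indicator (fun _ => ENNReal.ofReal b) t) := by
          refine setLIntegral_mono' measurableSet_Ioi fun t ht => ?_
          by_cases htK : t < K
          · rw [Set.indicator_of_mem (show t ∈ Set.Ioo 0 K from ⟨ht, htK⟩)]
            exact h _ (measurableSet_lt measurable_const hf)
          · have : {y | t < f y} = ∅ := by
              ext y; simpa using (hfK y).trans (not_lt.1 htK)
            rw [this]; simp
      _ = ENNReal.ofReal a * (∫⁻ t in Set.Ioi 0, ν {y | t < f y})
            + ∫⁻ t in Set.Ioi 0, (Set.Ioo 0 K).indicator (fun _ => ENNReal.ofReal b) t := by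
          rw [lintegral_add_left (hmeas.const_mul _), lintegral_const_mul _ hmeas]
      _ ≤ _ := by
          gcongr
          refine (setLIntegral_le_lintegral _ _).trans ?_
          rw [lintegral_indicator_const measurableSet_Ioo, Real.volume_Ioo, sub_zero]
  rw [← ofReal_integral_eq_lintegral_ofReal (hint μ) (Filter.Eventually.of_forall hf0),
    ← ofReal_integral_eq_lintegral_ofReal (hint ν) (Filter.Eventually.of_forall hf0),
    ← ENNReal.ofReal_mul ha, ← ENNReal.ofReal_mul hb, ← ENNReal.ofReal_add,
    ENNReal.ofReal_le_ofReal_iff] at key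
  · exact key
  · exact add_nonneg (mul_nonneg ha (integral_nonneg hf0)) (mul_nonneg hb hK)
  · exact mul_nonneg ha (integral_nonneg hf0)
  · exact mul_nonneg hb hK

/-- The signed version, for a bounded function and a two-sided privacy guarantee. -/
lemma integral_le_of_indistinguishable {𝒴 : Type*} [MeasurableSpace 𝒴] {μ ν : Measure 𝒴}
    [IsProbabilityMeasure μ] [IsProbabilityMeasure ν] {ε δ K : ℝ} (hε : 0 ≤ ε) (hδ : 0 ≤ δ)
    (h : ∀ S, MeasurableSet S → μ S ≤ ENNReal.ofReal (Real.exp ε) * ν S + ENNReal.ofReal δ)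
    (h' : ∀ S, MeasurableSet S → ν S ≤ ENNReal.ofReal (Real.exp ε) * μ S + ENNReal.ofReal δ)
    {f : 𝒴 → ℝ} (hf : Measurable f) (hfK : ∀ y, |f y| ≤ K) :
    ∫ y, f y ∂μ ≤ Real.cosh ε * ∫ y, f y ∂ν + Real.sinh ε * ∫ y, |f y| ∂ν + 2 * δ * K := by
  have hK : 0 ≤ K := by
    obtain ⟨y⟩ := nonempty_of_isProbabilityMeasure μ
    exact (abs_nonneg _).trans (hfK y)
  have hp := hf.max (measurable_const (a := (0 : ℝ)))
  have hn : Measurable fun y => max (-f y) 0 := hf.neg.max measurable_const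
  have hbp : ∀ y, max (f y) 0 ≤ K := fun y => max_le ((le_abs_self _).trans (hfK y)) hK
  have hbn : ∀ y, max (-f y) 0 ≤ K := fun y => max_le ((neg_le_abs _).trans (hfK y)) hK
  have ip : ∀ (ρ : Measure 𝒴) [IsProbabilityMeasure ρ], Integrable (fun y => max (f y) 0) ρ :=
    fun ρ _ => Integrable.of_bound hp.aestronglyMeasurable K (Filter.Eventually.of_forall fun y => by
      rw [Real.norm_of_nonneg (le_max_right _ _)]; exact hbp y)
  have iN : ∀ (ρ : Measure 𝒴) [IsProbabilityMeasure ρ], Integrable (fun y => max (-f y) 0) ρ :=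
    fun ρ _ => Integrable.of_bound hn.aestronglyMeasurable K (Filter.Eventually.of_forall fun y => by
      rw [Real.norm_of_nonneg (le_max_right _ _)]; exact hbn y)
  have e1 : ∀ (ρ : Measure 𝒴) [IsProbabilityMeasure ρ],
      ∫ y, f y ∂ρ = ∫ y, max (f y) 0 ∂ρ - ∫ y, max (-f y) 0 ∂ρ := fun ρ _ => by
    rw [← integral_sub (ip ρ) (iN ρ)]
    congr 1; ext y
    rcases le_total (f y) 0 with h0 | h0
    · rw [max_eq_right h0, max_eq_left (by linarith)]; ring
    · rw [max_eq_left h0, max_eq_right (by linarith)]; ring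
  have e2 : ∫ y, |f y| ∂ν = ∫ y, max (f y) 0 ∂ν + ∫ y, max (-f y) 0 ∂ν := by
    rw [← integral_add (ip ν) (iN ν)]
    congr 1; ext y
    rcases le_total (f y) 0 with h0 | h0
    · rw [max_eq_right h0, max_eq_left (by linarith), abs_of_nonpos h0]; ring
    · rw [max_eq_left h0, max_eq_right (by linarith), abs_of_nonneg h0]; ring
  -- The positive part is moved from `μ` to `ν` at factor `exp ε`. The negative part is bounded in
  -- the reverse direction, at factor `exp (-ε)`. The two factors combine into `cosh ε` on `f` and
  -- `sinh ε` on `|f|`.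
  have b1 := integral_le_of_forall_measure_le (Real.exp_pos ε).le hδ h hp
    (fun _ => le_max_right _ _) hbp
  have b2 := integral_le_of_forall_measure_le (Real.exp_pos ε).le hδ h' hn
    (fun _ => le_max_right _ _) hbn
  rw [e1 μ, e1 ν, e2, Real.cosh_eq, Real.sinh_eq]
  have hE : Real.exp (-ε) * Real.exp ε = 1 := by rw [← Real.exp_add]; simp
  have hE1 : Real.exp (-ε) ≤ 1 := Real.exp_le_one_iff.2 (by linarith)
  have b3 := mul_le_mul_of_nonneg_left b2 (Real.exp_pos (-ε)).le
  have : Real.exp (-ε) * (δ * K) ≤ δ * K := mul_le_of_le_one_left (mul_nonneg hδ hK) hE1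
  rw [mul_add, ← mul_assoc, hE, one_mul] at b3
  linarith

/-- Privacy bounds the correlation of an output statistic with the score of one sample. -/
lemma integral_inner_score_le {E 𝒳 𝒴 : Type*} [NormedAddCommGroup E] [InnerProductSpace ℝ E]
    [FiniteDimensional ℝ E] [MeasurableSpace E] [BorelSpace E]
    [MeasurableSpace 𝒳] [MeasurableSpace 𝒴] {n : ℕ}
    (P : Measure 𝒳) [IsProbabilityMeasure P] (M : Kernel (Fin n → 𝒳) 𝒴) [IsMarkovKernel M]
    {ε δ : ℝ} (hε : 0 ≤ ε) (hε1 : ε ≤ 1) (hδ : 0 ≤ δ)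
    (hDP : ∀ X i x S, MeasurableSet S → M X S ≤
      ENNReal.ofReal (Real.exp ε) * M (Function.update X i x) S + ENNReal.ofReal δ)
    {s : 𝒳 → E} (hs : Measurable s) (hsi : Integrable s P) (hs0 : ∫ x, s x ∂P = 0)
    {σ : ℝ} (hσ : ∀ a : E, ∫ x, |inner ℝ a (s x)| ∂P ≤ σ * ‖a‖)
    {A : 𝒴 → E} (hA : Measurable A) {R : ℝ} (hR : ∀ y, ‖A y‖ ≤ R) (i : Fin n) :
    ∫ X, ∫ y, inner ℝ (A y) (s (X i)) ∂(M X) ∂(Measure.pi fun _ => P) ≤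
      2 * ε * σ * (∫ X, ∫ y, ‖A y‖ ∂(M X) ∂(Measure.pi fun _ => P))
        + 2 * δ * R * ∫ x, ‖s x‖ ∂P := by
  set PP : Measure (Fin n → 𝒳) := Measure.pi fun _ => P with hPP
  have hF : Measurable fun q : 𝒴 × 𝒳 => inner ℝ (A q.1) (s q.2) :=
    (hA.comp measurable_fst).inner (hs.comp measurable_snd)
  have hFx : ∀ x, Measurable fun y => inner ℝ (A y) (s x) := fun x => hA.inner measurable_const
  have hFb : ∀ y x, |inner ℝ (A y) (s x)| ≤ R * ‖s x‖ := fun y x =>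
    (abs_real_inner_le_norm _ _).trans (mul_le_mul_of_nonneg_right (hR y) (norm_nonneg _))
  have hAi : ∀ X, Integrable (fun y => ‖A y‖) (M X) := fun X =>
    Integrable.of_bound hA.norm.aestronglyMeasurable R
      (Filter.Eventually.of_forall fun y => by simpa using hR y)
  -- the two functions of the data that appear after exchanging a sample
  have mG : ∀ H : ℝ → ℝ, Measurable H → StronglyMeasurable
      fun q : (Fin n → 𝒳) × 𝒳 => ∫ y, H (inner ℝ (A y) (s q.2)) ∂(M q.1) := by
    intro H hH
    have : StronglyMeasurable fun r : ((Fin n → 𝒳) × 𝒳) × 𝒴 =>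
        H (inner ℝ (A r.2) (s r.1.2)) :=
      (hH.comp (hF.comp (measurable_snd.prodMk
        (measurable_snd.comp measurable_fst)))).stronglyMeasurable
    exact this.integral_kernel_prod_right (κ := M.comap Prod.fst measurable_fst)
  have bG : ∀ H : ℝ → ℝ, (∀ t, |H t| ≤ |t|) → ∀ X x,
      ‖∫ y, H (inner ℝ (A y) (s x)) ∂(M X)‖ ≤ R * ‖s x‖ := by
    intro H hH X x
    have := norm_integral_le_of_norm_le_const (μ := M X) (C := R * ‖s x‖)
      (f := fun y => H (inner ℝ (A y) (s x)))
      (Filter.Eventually.of_forall fun y => (hH _).trans (hFb y x))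
    simpa using this
  have isnd : Integrable (fun q : (Fin n → 𝒳) × 𝒳 => R * ‖s q.2‖) (PP.prod P) :=
    (hsi.norm.comp_snd PP).const_mul R
  have iG : ∀ H : ℝ → ℝ, Measurable H → (∀ t, |H t| ≤ |t|) → Integrable
      (fun q : (Fin n → 𝒳) × 𝒳 => ∫ y, H (inner ℝ (A y) (s q.2)) ∂(M q.1)) (PP.prod P) :=
    fun H hH hb => isnd.mono' (mG H hH).aestronglyMeasurable
      (Filter.Eventually.of_forall fun q => bG H hb q.1 q.2)
  have hex := measurePreserving_exchange P i
  have iGid := iG id measurable_id (fun _ => le_rfl)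
  have iGabs := iG abs continuous_abs.measurable (fun t => by rw [abs_abs])
  simp only [id] at iGid
  -- pointwise privacy bound
  have hpt : ∀ X x, ∫ y, inner ℝ (A y) (s (X i)) ∂(M X)
      ≤ Real.cosh ε * ∫ y, inner ℝ (A y) (s (X i)) ∂(M (Function.update X i x))
        + Real.sinh ε * ∫ y, |inner ℝ (A y) (s (X i))| ∂(M (Function.update X i x))
        + 2 * δ * (R * ‖s (X i)‖) := by
    intro X x
    refine integral_le_of_indistinguishable hε hδ (fun S hS => hDP X i x S hS) (fun S hS => ?_)
      (hFx _) (fun y => hFb y _)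
    simpa using hDP (Function.update X i x) i (X i) S hS
  let G : (Fin n → 𝒳) × 𝒳 → ℝ := fun q =>
    Real.cosh ε * ∫ y, inner ℝ (A y) (s q.2) ∂(M q.1)
      + Real.sinh ε * ∫ y, |inner ℝ (A y) (s q.2)| ∂(M q.1) + 2 * δ * (R * ‖s q.2‖)
  have iGG : Integrable G (PP.prod P) :=
    ((iGid.const_mul _).add (iGabs.const_mul _)).add (isnd.const_mul _)
  have mL : StronglyMeasurable fun X : Fin n → 𝒳 => ∫ y, inner ℝ (A y) (s (X i)) ∂(M X) := by
    have := (mG id measurable_id).comp_measurable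
      (measurable_id.prodMk (measurable_pi_apply i) : Measurable fun X : Fin n → 𝒳 => (X, X i))
    exact this
  have iL : Integrable (fun X : Fin n → 𝒳 => ∫ y, inner ℝ (A y) (s (X i)) ∂(M X)) PP := by
    refine Integrable.mono' (g := fun X => R * ‖s (X i)‖) ?_ mL.aestronglyMeasurable
      (Filter.Eventually.of_forall fun X => bG id (fun _ => le_rfl) X (X i))
    exact ((integrable_comp_eval (μ := fun _ : Fin n => P) (i := i) hsi).norm).const_mul R
  -- After the exchange the output is computed from a dataset that is independent of the scored
  -- sample.
  have step : ∫ X, ∫ y, inner ℝ (A y) (s (X i)) ∂(M X) ∂PP ≤ ∫ q, G q ∂(PP.prod P) := by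
    rw [← hex.map_eq, integral_map hex.measurable.aemeasurable
      (by rw [hex.map_eq]; exact iGG.aestronglyMeasurable)]
    have : ∫ X, ∫ y, inner ℝ (A y) (s (X i)) ∂(M X) ∂PP
        = ∫ q : (Fin n → 𝒳) × 𝒳, ∫ y, inner ℝ (A y) (s (q.1 i)) ∂(M q.1) ∂(PP.prod P) := by
      rw [integral_prod _ (iL.comp_fst P)]
      simp
    rw [this]
    refine integral_mono (iL.comp_fst P) (hex.integrable_comp_of_integrable iGG) fun q => ?_
    exact hpt q.1 q.2
  refine step.trans ?_
  -- Independence and the zero mean of the score remove the `cosh ε` term, so only terms of size `ε`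
  -- and `δ` remain.
  have c1 : ∫ q : (Fin n → 𝒳) × 𝒳, ∫ y, inner ℝ (A y) (s q.2) ∂(M q.1) ∂(PP.prod P) = 0 := by
    rw [integral_prod _ iGid]
    refine integral_eq_zero_of_ae (Filter.Eventually.of_forall fun X => ?_)
    change ∫ x, ∫ y, inner ℝ (A y) (s x) ∂(M X) ∂P = 0
    rw [integral_integral_swap]
    · simp [integral_inner hsi, hs0]
    · refine (((hsi.norm.const_mul R).comp_fst (M X))).mono'
        (hF.comp measurable_swap).aestronglyMeasurable
        (Filter.Eventually.of_forall fun q => hFb q.2 q.1)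
  have c2 : ∫ q : (Fin n → 𝒳) × 𝒳, ∫ y, |inner ℝ (A y) (s q.2)| ∂(M q.1) ∂(PP.prod P)
      ≤ σ * ∫ X, ∫ y, ‖A y‖ ∂(M X) ∂PP := by
    have mA : StronglyMeasurable fun X : Fin n → 𝒳 => ∫ y, ‖A y‖ ∂(M X) :=
      StronglyMeasurable.integral_kernel_prod_right (κ := M)
        (f := fun _ y => ‖A y‖) (hA.norm.comp measurable_snd).stronglyMeasurable
    rw [integral_prod _ iGabs, ← integral_const_mul]
    refine integral_mono iGabs.integral_prod_left ?_ fun X => ?_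
    · refine Integrable.const_mul (Integrable.of_bound mA.aestronglyMeasurable R
        (Filter.Eventually.of_forall fun X => ?_)) σ
      have := norm_integral_le_of_norm_le_const (μ := M X) (C := R) (f := fun y => ‖A y‖)
        (Filter.Eventually.of_forall fun y => by simpa using hR y)
      simpa using this
    · change ∫ x, ∫ y, |inner ℝ (A y) (s x)| ∂(M X) ∂P ≤ _
      have ii : Integrable (fun q : 𝒳 × 𝒴 => |inner ℝ (A q.2) (s q.1)|) (P.prod (M X)) :=
        (((hsi.norm.const_mul R).comp_fst (M X))).mono'
          (hF.comp measurable_swap).abs.aestronglyMeasurable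
          (Filter.Eventually.of_forall fun q => by simpa using hFb q.2 q.1)
      rw [integral_integral_swap ii, ← integral_const_mul]
      exact integral_mono ii.integral_prod_right ((hAi X).const_mul σ) fun y => hσ (A y)
  have hσ0 : 0 ≤ σ * ∫ X, ∫ y, ‖A y‖ ∂(M X) ∂PP := le_trans
    (integral_nonneg fun q => integral_nonneg fun y => abs_nonneg _) c2
  have hsinh0 : 0 ≤ Real.sinh ε := Real.sinh_nonneg_iff.2 hε
  -- From `exp ε ≤ 1 + ε + ε ^ 2` and `exp (-ε) ≥ 1 - ε`; this is where `ε ≤ 1` enters.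
  have hsinh : Real.sinh ε ≤ 2 * ε := by
    have h1 := abs_le.1 (Real.abs_exp_sub_one_sub_id_le (x := ε) (by rw [abs_of_nonneg hε]; exact hε1))
    have h2 := Real.add_one_le_exp (-ε)
    rw [Real.sinh_eq]; nlinarith [h1.2]
  have e : ∫ q, G q ∂(PP.prod P) =
      Real.cosh ε * (∫ q : (Fin n → 𝒳) × 𝒳, ∫ y, inner ℝ (A y) (s q.2) ∂(M q.1) ∂(PP.prod P))
      + Real.sinh ε *
        (∫ q : (Fin n → 𝒳) × 𝒳, ∫ y, |inner ℝ (A y) (s q.2)| ∂(M q.1) ∂(PP.prod P))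
      + 2 * δ * (R * ∫ x, ‖s x‖ ∂P) := by
    simp only [G]
    have j : Integrable (fun q : (Fin n → 𝒳) × 𝒳 =>
        Real.cosh ε * ∫ y, inner ℝ (A y) (s q.2) ∂(M q.1)
          + Real.sinh ε * ∫ y, |inner ℝ (A y) (s q.2)| ∂(M q.1)) (PP.prod P) :=
      (iGid.const_mul _).add (iGabs.const_mul _)
    rw [integral_add j (isnd.const_mul _),
      integral_add (iGid.const_mul _) (iGabs.const_mul _), integral_const_mul, integral_const_mul,
      integral_const_mul, integral_const_mul]
    congr 3
    rw [integral_fun_snd (fun x => ‖s x‖)]; simp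
  rw [e, c1]
  have := mul_le_mul hsinh (le_refl (σ * ∫ X, ∫ y, ‖A y‖ ∂(M X) ∂PP)) hσ0 (by linarith)
  have := mul_le_mul_of_nonneg_left c2 hsinh0
  linarith

/-! ### The uniform prior on the cube and integration by parts -/

/-- The uniform distribution on `[-1, 1]`. -/
noncomputable def unifMeasure : Measure ℝ := (2⁻¹ : ENNReal) • volume.restrict (Set.Icc (-1) 1)

instance isProbabilityMeasure_unifMeasure : IsProbabilityMeasure unifMeasure := by
  refine ⟨?_⟩
  simp only [unifMeasure, Measure.smul_apply, Measure.restrict_apply_univ, Real.volume_Icc,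
    smul_eq_mul]
  norm_num
  exact ENNReal.inv_mul_cancel (by norm_num) (by norm_num)

/-- The uniform distribution on the cube `[-1, 1]^J`. -/
noncomputable def cubeMeasure (J : Type*) [Fintype J] : Measure (J → ℝ) :=
  Measure.pi fun _ => unifMeasure

instance isProbabilityMeasure_cubeMeasure (J : Type*) [Fintype J] :
    IsProbabilityMeasure (cubeMeasure J) :=
  inferInstanceAs (IsProbabilityMeasure (Measure.pi fun _ => unifMeasure))

lemma ae_unifMeasure_mem : ∀ᵐ t ∂unifMeasure, t ∈ Set.Icc (-1 : ℝ) 1 :=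
  Measure.ae_smul_measure (ae_restrict_mem measurableSet_Icc) _

lemma integral_unifMeasure (f : ℝ → ℝ) :
    ∫ t, f t ∂unifMeasure = 2⁻¹ * ∫ t in (-1 : ℝ)..1, f t := by
  rw [unifMeasure, integral_smul_measure, integral_Icc_eq_integral_Ioc,
    intervalIntegral.integral_of_le (by norm_num)]
  simp

lemma ae_cubeMeasure_mem (J : Type*) [Fintype J] :
    ∀ᵐ θ ∂cubeMeasure J, ∀ j, θ j ∈ Set.Icc (-1 : ℝ) 1 := by
  rw [ae_all_iff]
  intro j
  exact Measure.tendsto_eval_ae_ae (μ := fun _ : J => unifMeasure) ae_unifMeasure_mem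

/-- Integration by parts on `[-1, 1]` against the weight `1 - t²`, which vanishes at the ends. -/
lemma integral_weight_mul_deriv {q q' : ℝ → ℝ} (h : ∀ t, HasDerivAt q (q' t) t)
    (hc : Continuous q') :
    ∫ t, (1 - t ^ 2) * q' t ∂unifMeasure = ∫ t, 2 * t * q t ∂unifMeasure := by
  have hw : ∀ t : ℝ, HasDerivAt (fun t : ℝ => 1 - t ^ 2) (-(2 * t)) t := fun t => by
    simpa using (hasDerivAt_pow 2 t).const_sub 1
  rw [integral_unifMeasure, integral_unifMeasure,
    intervalIntegral.integral_mul_deriv_eq_deriv_mul (fun t _ => hw t) (fun t _ => h t)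
      (Continuous.intervalIntegrable (by fun_prop) _ _) (hc.intervalIntegrable _ _)]
  simp

lemma measurePreserving_update_cubeMeasure {J : Type*} [Fintype J] [DecidableEq J] (j : J) :
    MeasurePreserving (fun q : (J → ℝ) × ℝ => Function.update q.1 j q.2)
      ((cubeMeasure J).prod unifMeasure) (cubeMeasure J) :=
  measurePreserving_fst.comp (measurePreserving_exchange unifMeasure j)

/-- Resampling coordinate `j` preserves the prior. The inner integral is then one-dimensional with
the other coordinates frozen, which is the setting of `integral_weight_mul_deriv`. -/
lemma integral_cubeMeasure_update {J : Type*} [Fintype J] [DecidableEq J] (j : J)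
    {f : (J → ℝ) → ℝ} (hf : Integrable f (cubeMeasure J)) :
    ∫ θ, f θ ∂cubeMeasure J
      = ∫ θ, ∫ t, f (Function.update θ j t) ∂unifMeasure ∂cubeMeasure J := by
  have hp := measurePreserving_update_cubeMeasure j
  have := integral_map hp.measurable.aemeasurable (f := f)
    (by rw [hp.map_eq]; exact hf.aestronglyMeasurable)
  rw [hp.map_eq] at this
  exact this.trans (integral_prod _ (hp.integrable_comp_of_integrable hf))

/-- Integration by parts in one coordinate of the cube. -/
lemma integral_cubeMeasure_weight_mul_deriv {J : Type*} [Fintype J] [DecidableEq J] (j : J)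
    {q D : (J → ℝ) → ℝ}
    (h : ∀ θ, HasDerivAt (fun t => q (Function.update θ j t)) (D θ) (θ j))
    (hc : ∀ θ, Continuous fun t => D (Function.update θ j t))
    (hD : Integrable (fun θ => (1 - θ j ^ 2) * D θ) (cubeMeasure J))
    (hq : Integrable (fun θ => 2 * θ j * q θ) (cubeMeasure J)) :
    ∫ θ, (1 - θ j ^ 2) * D θ ∂cubeMeasure J = ∫ θ, 2 * θ j * q θ ∂cubeMeasure J := by
  rw [integral_cubeMeasure_update j hD, integral_cubeMeasure_update j hq]
  congr 1; ext θ
  simp only [Function.update_self]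
  refine integral_weight_mul_deriv (fun t => ?_) (hc θ)
  simpa using h (Function.update θ j t)

/-- Integration by parts in one coordinate of the prior, for the expectation of a bounded
statistic under a dominated family with density `q` and density derivative `D`. -/
lemma integral_weight_mul_integral_deriv {J Y : Type*} [Fintype J] [DecidableEq J]
    [MeasurableSpace Y] (μ : Measure Y) [SigmaFinite μ] (j : J) {q D : (J → ℝ) → Y → ℝ}
    (h : ∀ θ y, HasDerivAt (fun t => q (Function.update θ j t) y) (D θ y) (θ j))
    (hc : ∀ θ y, Continuous fun t => D (Function.update θ j t) y)
    (hD : Integrable (Function.uncurry D) ((cubeMeasure J).prod μ))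
    (hq : Integrable (Function.uncurry q) ((cubeMeasure J).prod μ))
    {g : Y → ℝ} (hg : Measurable g) {K : ℝ} (hgK : ∀ y, |g y| ≤ K) :
    ∫ θ, (1 - θ j ^ 2) * ∫ y, g y * D θ y ∂μ ∂cubeMeasure J
      = ∫ θ, 2 * θ j * ∫ y, g y * q θ y ∂μ ∂cubeMeasure J := by
  have hae : ∀ᵐ r : (J → ℝ) × Y ∂(cubeMeasure J).prod μ, r.1 j ∈ Set.Icc (-1 : ℝ) 1 :=
    Measure.quasiMeasurePreserving_fst.ae ((ae_cubeMeasure_mem J).mono fun θ hθ => hθ j)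
  have hm : Measurable fun r : (J → ℝ) × Y => r.1 j := (measurable_pi_apply j).comp measurable_fst
  have i1 : Integrable (fun r : (J → ℝ) × Y => (1 - r.1 j ^ 2) * (g r.2 * D r.1 r.2))
      ((cubeMeasure J).prod μ) := by
    refine Integrable.bdd_mul (c := 1) ?_
      ((measurable_const.sub (hm.pow_const 2)).aestronglyMeasurable) ?_
    · exact hD.bdd_mul (c := K) (hg.comp measurable_snd).aestronglyMeasurable
        (Filter.Eventually.of_forall fun r => hgK r.2)
    · filter_upwards [hae] with r hr
      rw [Real.norm_eq_abs, abs_le]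
      constructor <;> nlinarith [hr.1, hr.2]
  have i2 : Integrable (fun r : (J → ℝ) × Y => 2 * r.1 j * (g r.2 * q r.1 r.2))
      ((cubeMeasure J).prod μ) := by
    refine Integrable.bdd_mul (c := 2) ?_ ((measurable_const.mul hm).aestronglyMeasurable) ?_
    · exact hq.bdd_mul (c := K) (hg.comp measurable_snd).aestronglyMeasurable
        (Filter.Eventually.of_forall fun r => hgK r.2)
    · filter_upwards [hae] with r hr
      rw [Real.norm_eq_abs, abs_le]
      constructor <;> linarith [hr.1, hr.2]
  simp_rw [← integral_const_mul]
  -- Fubini puts the prior inside, so integration by parts takes place for each fixed `y` and no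
  -- derivative has to pass under an integral sign.
  rw [integral_integral_swap (f := fun θ y => (1 - θ j ^ 2) * (g y * D θ y)) i1,
    integral_integral_swap (f := fun θ y => 2 * θ j * (g y * q θ y)) i2]
  refine integral_congr_ae ?_
  filter_upwards [i1.prod_left_ae, i2.prod_left_ae] with y h1 h2
  exact integral_cubeMeasure_weight_mul_deriv j (q := fun θ => g y * q θ y)
    (D := fun θ => g y * D θ y) (fun θ => (h θ y).const_mul (g y))
    (fun θ => continuous_const.mul (hc θ y)) h1 h2

/-! ### Score models and the fingerprinting bound -/

/-- A dominated parametric family of probability laws, indexed by `J → ℝ`, that is differentiable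
in every coordinate, with bounds on the moments of its score. -/
structure ScoreModel (J 𝒳 : Type*) [Fintype J] [DecidableEq J] [MeasurableSpace 𝒳] where
  base : Measure 𝒳
  sigmaFinite : SigmaFinite base
  pdf : (J → ℝ) → 𝒳 → ℝ
  measurable_pdf : Measurable (Function.uncurry pdf)
  pdf_nonneg : ∀ θ x, 0 ≤ pdf θ x
  score : (J → ℝ) → 𝒳 → EuclideanSpace ℝ J
  measurable_score : Measurable (Function.uncurry score)
  hasDerivAt_pdf : ∀ θ x j,
    HasDerivAt (fun t => pdf (Function.update θ j t) x) (pdf θ x * score θ x j) (θ j)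
  continuous_score : ∀ θ x j, Continuous fun t => score (Function.update θ j t) x j
  isProbabilityMeasure : ∀ θ,
    IsProbabilityMeasure (base.withDensity fun x => ENNReal.ofReal (pdf θ x))
  integrable_score : ∀ θ,
    Integrable (score θ) (base.withDensity fun x => ENNReal.ofReal (pdf θ x))
  integral_score : ∀ θ, ∫ x, score θ x ∂(base.withDensity fun x => ENNReal.ofReal (pdf θ x)) = 0
  -- `σ` controls the score in a single direction and enters the main privacy term. `κ` controls its
  -- full norm, may be larger, and is only ever multiplied by `δ`.
  σ : ℝ
  integral_abs_inner_le : ∀ θ (a : EuclideanSpace ℝ J),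
    ∫ x, |inner ℝ a (score θ x)| ∂(base.withDensity fun x => ENNReal.ofReal (pdf θ x)) ≤ σ * ‖a‖
  κ : ℝ
  integral_norm_score_le : ∀ θ,
    ∫ x, ‖score θ x‖ ∂(base.withDensity fun x => ENNReal.ofReal (pdf θ x)) ≤ κ

namespace ScoreModel

variable {J 𝒳 : Type*} [Fintype J] [DecidableEq J] [MeasurableSpace 𝒳] (m : ScoreModel J 𝒳)

/-- The law of one sample. -/
noncomputable def law (θ : J → ℝ) : Measure 𝒳 :=
  m.base.withDensity fun x => ENNReal.ofReal (m.pdf θ x)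

instance (θ : J → ℝ) : IsProbabilityMeasure (m.law θ) := m.isProbabilityMeasure θ

instance : SigmaFinite m.base := m.sigmaFinite

/-- The density of `n` independent samples. -/
noncomputable def pdfN {n : ℕ} (θ : J → ℝ) (X : Fin n → 𝒳) : ℝ := ∏ i, m.pdf θ (X i)

/-- The derivative of the density of `n` independent samples in one coordinate. -/
noncomputable def derivN {n : ℕ} (j : J) (θ : J → ℝ) (X : Fin n → 𝒳) : ℝ :=
  m.pdfN θ X * ∑ i, m.score θ (X i) j

lemma measurable_pdf_right (θ : J → ℝ) : Measurable (m.pdf θ) :=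
  m.measurable_pdf.comp (measurable_const.prodMk measurable_id)

lemma measurable_score_right (θ : J → ℝ) : Measurable (m.score θ) :=
  m.measurable_score.comp (measurable_const.prodMk measurable_id)

lemma integrable_pdf (θ : J → ℝ) : Integrable (m.pdf θ) m.base := by
  refine ⟨(m.measurable_pdf_right θ).aestronglyMeasurable, ?_⟩
  rw [hasFiniteIntegral_iff_ofReal (Filter.Eventually.of_forall (m.pdf_nonneg θ))]
  have : m.law θ Set.univ = 1 := measure_univ
  rw [law, withDensity_apply _ MeasurableSet.univ, Measure.restrict_univ] at this
  rw [this]; exact ENNReal.one_lt_top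

lemma pdfN_nonneg {n : ℕ} (θ : J → ℝ) (X : Fin n → 𝒳) : 0 ≤ m.pdfN θ X :=
  Finset.prod_nonneg fun _ _ => m.pdf_nonneg _ _

lemma measurable_pdfN (n : ℕ) :
    Measurable (Function.uncurry (m.pdfN (n := n))) := by
  unfold pdfN Function.uncurry
  exact Finset.measurable_prod _ fun i _ => m.measurable_pdf.comp
    (measurable_fst.prodMk ((measurable_pi_apply i).comp measurable_snd))

lemma measurable_derivN (n : ℕ) (j : J) :
    Measurable (Function.uncurry (m.derivN (n := n) j)) := by
  refine (m.measurable_pdfN n).mul (Finset.measurable_sum _ fun i _ => ?_)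
  have h : Measurable fun q : (J → ℝ) × (Fin n → 𝒳) => m.score q.1 (q.2 i) :=
    m.measurable_score.comp
      (measurable_fst.prodMk ((measurable_pi_apply i).comp measurable_snd))
  exact (EuclideanSpace.proj (𝕜 := ℝ) j).measurable.comp h

lemma pi_law_eq (n : ℕ) (θ : J → ℝ) :
    Measure.pi (fun _ : Fin n => m.law θ) = (Measure.pi fun _ : Fin n => m.base).withDensity
      fun X => ENNReal.ofReal (m.pdfN θ X) :=
  pi_withDensity_ofReal m.base _ (m.pdf_nonneg θ) (m.integrable_pdf θ)

lemma measurable_pdfN_right {n : ℕ} (θ : J → ℝ) :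
    Measurable fun X : Fin n → 𝒳 => m.pdfN θ X :=
  (m.measurable_pdfN n).comp (measurable_const.prodMk measurable_id)

lemma integral_pi_law {n : ℕ} (θ : J → ℝ) (G : (Fin n → 𝒳) → ℝ) :
    ∫ X, G X ∂(Measure.pi fun _ : Fin n => m.law θ)
      = ∫ X, m.pdfN θ X * G X ∂(Measure.pi fun _ : Fin n => m.base) := by
  rw [pi_law_eq, integral_withDensity_eq_integral_toReal_smul
    (m.measurable_pdfN_right θ).ennreal_ofReal
    (Filter.Eventually.of_forall fun _ => ENNReal.ofReal_lt_top)]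
  simp [ENNReal.toReal_ofReal (m.pdfN_nonneg _ _)]

lemma integrable_pi_law_iff {n : ℕ} (θ : J → ℝ) (G : (Fin n → 𝒳) → ℝ) :
    Integrable G (Measure.pi fun _ : Fin n => m.law θ) ↔
      Integrable (fun X => m.pdfN θ X * G X) (Measure.pi fun _ : Fin n => m.base) := by
  rw [pi_law_eq, integrable_withDensity_iff_integrable_smul'
    (m.measurable_pdfN_right θ).ennreal_ofReal
    (Filter.Eventually.of_forall fun _ => ENNReal.ofReal_lt_top)]
  simp [ENNReal.toReal_ofReal (m.pdfN_nonneg _ _)]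

lemma hasDerivAt_pdfN {n : ℕ} (j : J) (θ : J → ℝ) (X : Fin n → 𝒳) :
    HasDerivAt (fun t => m.pdfN (Function.update θ j t) X) (m.derivN j θ X) (θ j) := by
  have := HasDerivAt.fun_finsetProd (u := Finset.univ)
    (fun i (_ : i ∈ Finset.univ) => m.hasDerivAt_pdf θ (X i) j)
  refine this.congr_deriv ?_
  simp only [Function.update_eq_self, smul_eq_mul, derivN, pdfN, Finset.mul_sum]
  refine Finset.sum_congr rfl fun i _ => ?_
  rw [← Finset.mul_prod_erase _ _ (Finset.mem_univ i)]; ring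

lemma continuous_pdf_update (θ : J → ℝ) (x : 𝒳) (j : J) :
    Continuous fun t => m.pdf (Function.update θ j t) x := by
  refine continuous_iff_continuousAt.2 fun t => ?_
  have := (m.hasDerivAt_pdf (Function.update θ j t) x j).continuousAt
  simpa using this

lemma continuous_derivN {n : ℕ} (j : J) (θ : J → ℝ) (X : Fin n → 𝒳) :
    Continuous fun t => m.derivN j (Function.update θ j t) X :=
  (continuous_finsetProd _ fun _ _ => m.continuous_pdf_update _ _ _).mul
    (continuous_finsetSum _ fun _ _ => m.continuous_score _ _ _)

lemma integrable_score_coord (θ : J → ℝ) (j : J) :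
    Integrable (fun x => m.score θ x j) (m.law θ) :=
  (EuclideanSpace.proj (𝕜 := ℝ) j).integrable_comp (m.integrable_score θ)

lemma integral_score_coord (θ : J → ℝ) (j : J) : ∫ x, m.score θ x j ∂m.law θ = 0 := by
  have := (EuclideanSpace.proj (𝕜 := ℝ) j).integral_comp_comm (m.integrable_score θ)
  rw [m.integral_score] at this
  simpa [law] using this

lemma integral_abs_score_coord_le (θ : J → ℝ) (j : J) : ∫ x, |m.score θ x j| ∂m.law θ ≤ m.σ := by
  have := m.integral_abs_inner_le θ (EuclideanSpace.single j 1)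
  simpa [law, EuclideanSpace.inner_single_left] using this

lemma integrable_score_eval {n : ℕ} (θ : J → ℝ) (j : J) (i : Fin n) :
    Integrable (fun X : Fin n → 𝒳 => m.score θ (X i) j) (Measure.pi fun _ : Fin n => m.law θ) :=
  integrable_comp_eval (μ := fun _ : Fin n => m.law θ) (i := i) (m.integrable_score_coord θ j)

lemma integrable_pdfN_prod (n : ℕ) :
    Integrable (Function.uncurry (m.pdfN (n := n)))
      ((cubeMeasure J).prod (Measure.pi fun _ : Fin n => m.base)) := by
  have hone : ∀ θ, Integrable (fun X : Fin n → 𝒳 => m.pdfN θ X)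
      (Measure.pi fun _ : Fin n => m.base) := fun θ => by
    have := (m.integrable_pi_law_iff (n := n) θ fun _ => 1).1 (integrable_const _)
    simpa using this
  rw [integrable_prod_iff (m.measurable_pdfN n).aestronglyMeasurable]
  refine ⟨Filter.Eventually.of_forall hone, ?_⟩
  refine (integrable_const (1 : ℝ)).congr (Filter.Eventually.of_forall fun θ => ?_)
  have := m.integral_pi_law (n := n) θ fun _ => 1
  simp only [integral_const, probReal_univ, smul_eq_mul, mul_one] at this
  simp only [Function.uncurry, Real.norm_of_nonneg (m.pdfN_nonneg _ _)]
  exact this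

/-- Against the law of `θ` the derivative of the density becomes a sum of `n` scores. Its absolute
mean is at most `n * σ`, uniformly in `θ`, which gives the integrability that Fubini needs. -/
lemma integrable_derivN_prod (n : ℕ) (j : J) :
    Integrable (Function.uncurry (m.derivN (n := n) j))
      ((cubeMeasure J).prod (Measure.pi fun _ : Fin n => m.base)) := by
  have hone : ∀ θ, Integrable (fun X : Fin n → 𝒳 => m.derivN j θ X)
      (Measure.pi fun _ : Fin n => m.base) := fun θ =>
    (m.integrable_pi_law_iff (n := n) θ _).1
      (integrable_finsetSum _ fun i _ => m.integrable_score_eval θ j i)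
  have hms := (m.measurable_derivN n j).stronglyMeasurable
  rw [integrable_prod_iff (m.measurable_derivN n j).aestronglyMeasurable]
  refine ⟨Filter.Eventually.of_forall hone, ?_⟩
  refine Integrable.of_bound (C := n * m.σ)
    (hms.norm.integral_prod_right).aestronglyMeasurable
    (Filter.Eventually.of_forall fun θ => ?_)
  rw [Real.norm_of_nonneg (integral_nonneg fun _ => norm_nonneg _)]
  have e : ∫ X : Fin n → 𝒳, ‖m.derivN j θ X‖ ∂(Measure.pi fun _ : Fin n => m.base)
      = ∫ X : Fin n → 𝒳, |∑ i, m.score θ (X i) j| ∂(Measure.pi fun _ : Fin n => m.law θ) := by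
    rw [integral_pi_law]
    simp only [derivN, norm_mul, Real.norm_of_nonneg (m.pdfN_nonneg _ _), Real.norm_eq_abs]
  refine e.trans_le ?_
  calc _ ≤ ∫ X : Fin n → 𝒳, ∑ i, |m.score θ (X i) j| ∂(Measure.pi fun _ : Fin n => m.law θ) :=
        integral_mono (integrable_finsetSum _ fun i _ => m.integrable_score_eval θ j i).abs
          (integrable_finsetSum _ fun i _ => (m.integrable_score_eval θ j i).abs)
          fun X => Finset.abs_sum_le_sum_abs _ _
    _ = ∑ i : Fin n, ∫ x, |m.score θ x j| ∂m.law θ := by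
        rw [integral_finsetSum _ fun i _ => (m.integrable_score_eval θ j i).abs]
        refine Finset.sum_congr rfl fun i _ => ?_
        exact integral_comp_eval (μ := fun _ : Fin n => m.law θ) (i := i)
          (m.integrable_score_coord θ j).abs.aestronglyMeasurable
    _ ≤ ∑ _i : Fin n, m.σ := Finset.sum_le_sum fun i _ => m.integral_abs_score_coord_le θ j
    _ = n * m.σ := by simp

/-- The fingerprinting lower bound: an accurate private algorithm needs many samples. -/
theorem fingerprinting_bound {𝒴 : Type*} [MeasurableSpace 𝒴] {n : ℕ}
    (M : Kernel (Fin n → 𝒳) 𝒴) [IsMarkovKernel M]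
    {ε δ : ℝ} (hε : 0 ≤ ε) (hε1 : ε ≤ 1) (hδ : 0 ≤ δ)
    (hDP : ∀ X i x S, MeasurableSet S → M X S ≤
      ENNReal.ofReal (Real.exp ε) * M (Function.update X i x) S + ENNReal.ofReal δ)
    {φ : 𝒴 → EuclideanSpace ℝ J} (hφ : Measurable φ)
    {τ : (J → ℝ) → EuclideanSpace ℝ J} (hτ : Measurable τ) {R : ℝ}
    (hR : ∀ θ : J → ℝ, (∀ j, θ j ∈ Set.Icc (-1 : ℝ) 1) → ∀ y, ‖φ y - τ θ‖ ≤ R)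
    {e : ℝ} (he : e = ∫ θ, ∫ X, ∫ y, ‖φ y - τ θ‖ ∂(M X) ∂(Measure.pi fun _ => m.law θ)
      ∂cubeMeasure J) :
    ∫ θ, ∑ j, 2 * θ j * τ θ j ∂cubeMeasure J - 2 * √(Fintype.card J) * e
      ≤ n * (2 * ε * m.σ * e + 2 * δ * R * m.κ) := by
  have hcoord : ∀ j, Measurable fun v : EuclideanSpace ℝ J => v j := fun j =>
    (EuclideanSpace.proj (𝕜 := ℝ) j).measurable
  have h0mem : ∀ j : J, (0 : J → ℝ) j ∈ Set.Icc (-1 : ℝ) 1 := fun j => by simp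
  -- The error bound at the single parameter `θ = 0` already makes `φ` bounded.
  set K : ℝ := R + ‖τ 0‖ with hK
  have hφK : ∀ y, ‖φ y‖ ≤ K := fun y => by
    have := norm_sub_norm_le (φ y) (τ 0)
    linarith [hR 0 h0mem y]
  have hφj : ∀ y j, |φ y j| ≤ K := fun y j => (PiLp.norm_apply_le (φ y) j).trans (hφK y)
  have hφi : ∀ X j, Integrable (fun y => φ y j) (M X) := fun X j =>
    Integrable.of_bound ((hcoord j).comp hφ).aestronglyMeasurable K
      (Filter.Eventually.of_forall fun y => hφj y j)
  let g : J → (Fin n → 𝒳) → ℝ := fun j X => ∫ y, φ y j ∂(M X)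
  have hg : ∀ j, Measurable (g j) := fun j =>
    (StronglyMeasurable.integral_kernel_prod_right (κ := M) (f := fun _ y => φ y j)
      (((hcoord j).comp hφ).comp measurable_snd).stronglyMeasurable).measurable
  have hgK : ∀ j X, |g j X| ≤ K := fun j X => by
    have := norm_integral_le_of_norm_le_const (μ := M X) (C := K) (f := fun y => φ y j)
      (Filter.Eventually.of_forall fun y => hφj y j)
    simpa using this
  have hgi : ∀ θ j, Integrable (g j) (Measure.pi fun _ : Fin n => m.law θ) := fun θ j =>
    Integrable.of_bound (hg j).aestronglyMeasurable K (Filter.Eventually.of_forall (hgK j))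
  let err : (J → ℝ) → ℝ := fun θ =>
    ∫ X, ∫ y, ‖φ y - τ θ‖ ∂(M X) ∂(Measure.pi fun _ : Fin n => m.law θ)
  have hdm : ∀ θ, Measurable fun y => ‖φ y - τ θ‖ := fun θ => (hφ.sub measurable_const).norm
  have hdi : ∀ θ : J → ℝ, (∀ j, θ j ∈ Set.Icc (-1 : ℝ) 1) → ∀ X,
      Integrable (fun y => ‖φ y - τ θ‖) (M X) := fun θ hθ X =>
    Integrable.of_bound (hdm θ).aestronglyMeasurable R
      (Filter.Eventually.of_forall fun y => by simpa using hR θ hθ y)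
  have hdX : ∀ θ, StronglyMeasurable fun X => ∫ y, ‖φ y - τ θ‖ ∂(M X) := fun θ =>
    StronglyMeasurable.integral_kernel_prod_right (κ := M) (f := fun _ y => ‖φ y - τ θ‖)
      ((hdm θ).comp measurable_snd).stronglyMeasurable
  have hdXR : ∀ θ : J → ℝ, (∀ j, θ j ∈ Set.Icc (-1 : ℝ) 1) → ∀ X,
      |∫ y, ‖φ y - τ θ‖ ∂(M X)| ≤ R := fun θ hθ X => by
    have := norm_integral_le_of_norm_le_const (μ := M X) (C := R) (f := fun y => ‖φ y - τ θ‖)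
      (Filter.Eventually.of_forall fun y => by simpa using hR θ hθ y)
    simpa using this
  have hdXi : ∀ θ : J → ℝ, (∀ j, θ j ∈ Set.Icc (-1 : ℝ) 1) →
      Integrable (fun X => ∫ y, ‖φ y - τ θ‖ ∂(M X)) (Measure.pi fun _ : Fin n => m.law θ) :=
    fun θ hθ => Integrable.of_bound (hdX θ).aestronglyMeasurable R
      (Filter.Eventually.of_forall (hdXR θ hθ))
  -- integrability of the error over the prior
  have herr : Integrable err (cubeMeasure J) := by
    have hme : StronglyMeasurable err := by
      have h1 : StronglyMeasurable fun q : ((J → ℝ) × (Fin n → 𝒳)) =>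
          ∫ y, ‖φ y - τ q.1‖ ∂(M q.2) :=
        StronglyMeasurable.integral_kernel_prod_right (κ := M.comap Prod.snd measurable_snd)
          (f := fun (q : (J → ℝ) × (Fin n → 𝒳)) y => ‖φ y - τ q.1‖)
          ((hφ.comp measurable_snd).sub
            (hτ.comp (measurable_fst.comp measurable_fst))).norm.stronglyMeasurable
      have h2 := ((m.measurable_pdfN n).stronglyMeasurable.mul h1).integral_prod_right'
        (ν := Measure.pi fun _ : Fin n => m.base)
      have h3 : err = fun θ => ∫ X, m.pdfN θ X * ∫ y, ‖φ y - τ θ‖ ∂(M X)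
          ∂(Measure.pi fun _ : Fin n => m.base) := by
        ext1 θ
        exact m.integral_pi_law θ _
      rw [h3]; exact h2
    refine Integrable.of_bound hme.aestronglyMeasurable R ?_
    filter_upwards [ae_cubeMeasure_mem J] with θ hθ
    have := norm_integral_le_of_norm_le_const (μ := Measure.pi fun _ : Fin n => m.law θ) (C := R)
      (f := fun X => ∫ y, ‖φ y - τ θ‖ ∂(M X)) (Filter.Eventually.of_forall (hdXR θ hθ))
    simpa using this
  -- privacy bounds the correlation with the score
  have hU : ∀ θ : J → ℝ, (∀ j, θ j ∈ Set.Icc (-1 : ℝ) 1) →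
      ∑ j, (1 - θ j ^ 2) * ∫ X, g j X * m.derivN j θ X ∂(Measure.pi fun _ : Fin n => m.base)
        ≤ n * (2 * ε * m.σ * err θ + 2 * δ * R * m.κ) := by
    intro θ hθ
    have hw : ∀ j, 0 ≤ 1 - θ j ^ 2 ∧ 1 - θ j ^ 2 ≤ 1 := fun j =>
      ⟨by nlinarith [(hθ j).1, (hθ j).2], by nlinarith [sq_nonneg (θ j)]⟩
    -- The weights are absorbed into the statistic; being in `[0, 1]`, they do not increase its
    -- norm. Centring at `τ θ` costs nothing because the score has mean zero, and it brings the norm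
    -- down to the estimation error.
    let A : 𝒴 → EuclideanSpace ℝ J := fun y =>
      WithLp.toLp 2 fun j => (1 - θ j ^ 2) * (φ y j - τ θ j)
    have hA : Measurable A := by
      refine (WithLp.measurable_toLp 2 (J → ℝ)).comp (measurable_pi_lambda _ fun j => ?_)
      exact (((hcoord j).comp hφ).sub measurable_const).const_mul _
    have hAle : ∀ y, ‖A y‖ ≤ ‖φ y - τ θ‖ := by
      intro y
      rw [EuclideanSpace.norm_eq, EuclideanSpace.norm_eq]
      refine Real.sqrt_le_sqrt (Finset.sum_le_sum fun j _ => ?_)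
      simp only [A, Real.norm_eq_abs, abs_mul, PiLp.sub_apply]
      rw [abs_of_nonneg (hw j).1]
      have : (1 - θ j ^ 2) * |φ y j - τ θ j| ≤ |φ y j - τ θ j| :=
        mul_le_of_le_one_left (abs_nonneg _) (hw j).2
      exact pow_le_pow_left₀ (mul_nonneg (hw j).1 (abs_nonneg _)) this 2
    -- The sign of `σ` follows from its defining bound as soon as there is a coordinate; without
    -- coordinates all norms vanish.
    have hσ0 : 0 ≤ m.σ ∨ IsEmpty J := by
      by_cases h : Nonempty J
      · obtain ⟨j⟩ := h
        exact Or.inl ((integral_nonneg fun _ => abs_nonneg _).trans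
          (m.integral_abs_score_coord_le θ j))
      · exact Or.inr (not_nonempty_iff.1 h)
    have hAerr : m.σ * ∫ X, ∫ y, ‖A y‖ ∂(M X) ∂(Measure.pi fun _ : Fin n => m.law θ)
        ≤ m.σ * err θ := by
      rcases hσ0 with hσ0 | hJ
      · refine mul_le_mul_of_nonneg_left ?_ hσ0
        refine integral_mono_of_nonneg
          (Filter.Eventually.of_forall fun X => integral_nonneg fun _ => norm_nonneg _) (hdXi θ hθ)
          (Filter.Eventually.of_forall fun X => ?_)
        exact integral_mono_of_nonneg (Filter.Eventually.of_forall fun _ => norm_nonneg _)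
          (hdi θ hθ X) (Filter.Eventually.of_forall hAle)
      · have : ∀ v : EuclideanSpace ℝ J, ‖v‖ = 0 := fun v => by
          rw [EuclideanSpace.norm_eq]; simp
        simp [err, this]
    have hone : ∀ i : Fin n, ∑ j, (1 - θ j ^ 2) *
        ∫ X, g j X * m.score θ (X i) j ∂(Measure.pi fun _ : Fin n => m.law θ)
        ≤ 2 * ε * m.σ * err θ + 2 * δ * R * m.κ := by
      intro i
      have hb := integral_inner_score_le (m.law θ) M hε hε1 hδ hDP (m.measurable_score_right θ)
        (m.integrable_score θ) (m.integral_score θ) (m.integral_abs_inner_le θ) hA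
        (fun y => (hAle y).trans (hR θ hθ y)) i
      have hlhs : ∫ X, ∫ y, inner ℝ (A y) (m.score θ (X i)) ∂(M X)
            ∂(Measure.pi fun _ : Fin n => m.law θ)
          = ∑ j, (1 - θ j ^ 2) *
            ∫ X, g j X * m.score θ (X i) j ∂(Measure.pi fun _ : Fin n => m.law θ) := by
        have h1 : ∀ X : Fin n → 𝒳, ∫ y, inner ℝ (A y) (m.score θ (X i)) ∂(M X)
            = ∑ j, (1 - θ j ^ 2) *
              (g j X * m.score θ (X i) j - τ θ j * m.score θ (X i) j) := by
          intro X
          simp only [PiLp.inner_apply, RCLike.inner_apply, conj_trivial, A]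
          rw [integral_finsetSum]
          · refine Finset.sum_congr rfl fun j _ => ?_
            rw [integral_const_mul, integral_const_mul, integral_sub (hφi X j) (integrable_const _)]
            simp only [integral_const, probReal_univ, one_smul, g]
            ring
          · intro j _
            exact (((hφi X j).sub (integrable_const _)).const_mul _).const_mul _
        simp_rw [h1]
        have hgs : ∀ j, Integrable (fun X : Fin n → 𝒳 => g j X * m.score θ (X i) j)
            (Measure.pi fun _ : Fin n => m.law θ) := fun j =>
          (m.integrable_score_eval θ j i).bdd_mul (c := K) (hg j).aestronglyMeasurable
            (Filter.Eventually.of_forall (hgK j))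
        rw [integral_finsetSum]
        · refine Finset.sum_congr rfl fun j _ => ?_
          rw [integral_const_mul, integral_sub (hgs j)
            ((m.integrable_score_eval θ j i).const_mul _), integral_const_mul]
          have : ∫ X : Fin n → 𝒳, m.score θ (X i) j ∂(Measure.pi fun _ : Fin n => m.law θ)
              = ∫ x, m.score θ x j ∂m.law θ :=
            integral_comp_eval (μ := fun _ : Fin n => m.law θ) (i := i)
              (m.integrable_score_coord θ j).aestronglyMeasurable
          rw [this, m.integral_score_coord, mul_zero, sub_zero]
        · intro j _
          exact ((hgs j).sub ((m.integrable_score_eval θ j i).const_mul _)).const_mul _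
      rw [← hlhs]
      refine hb.trans (add_le_add ?_ ?_)
      · have := mul_le_mul_of_nonneg_left hAerr (mul_nonneg zero_le_two hε)
        linarith
      · obtain ⟨X⟩ := nonempty_of_isProbabilityMeasure (Measure.pi fun _ : Fin n => m.law θ)
        obtain ⟨y⟩ := nonempty_of_isProbabilityMeasure (M X)
        exact mul_le_mul_of_nonneg_left (m.integral_norm_score_le θ)
          (mul_nonneg (mul_nonneg zero_le_two hδ) ((norm_nonneg _).trans (hR θ hθ y)))
    calc ∑ j, (1 - θ j ^ 2) * ∫ X, g j X * m.derivN j θ X ∂(Measure.pi fun _ : Fin n => m.base)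
        = ∑ i : Fin n, ∑ j, (1 - θ j ^ 2) *
            ∫ X, g j X * m.score θ (X i) j ∂(Measure.pi fun _ : Fin n => m.law θ) := by
          rw [Finset.sum_comm]
          refine Finset.sum_congr rfl fun j _ => ?_
          rw [← Finset.mul_sum, ← integral_finsetSum]
          · rw [integral_pi_law]
            congr 2; ext X
            simp only [derivN, ← Finset.mul_sum]; ring
          · intro i _
            exact (m.integrable_score_eval θ j i).bdd_mul (c := K) (hg j).aestronglyMeasurable
              (Filter.Eventually.of_forall (hgK j))
      _ ≤ ∑ _i : Fin n, (2 * ε * m.σ * err θ + 2 * δ * R * m.κ) :=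
          Finset.sum_le_sum fun i _ => hone i
      _ = _ := by simp; ring
  -- accuracy forces correlation with the parameter
  have hL : ∀ θ : J → ℝ, (∀ j, θ j ∈ Set.Icc (-1 : ℝ) 1) →
      ∑ j, 2 * θ j * τ θ j - 2 * √(Fintype.card J) * err θ ≤
        ∑ j, 2 * θ j * ∫ X, g j X * m.pdfN θ X ∂(Measure.pi fun _ : Fin n => m.base) := by
    intro θ hθ
    have hθn : ‖(WithLp.toLp 2 θ : EuclideanSpace ℝ J)‖ ≤ √(Fintype.card J) := by
      rw [EuclideanSpace.norm_eq]
      refine Real.sqrt_le_sqrt ?_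
      calc ∑ j, ‖θ j‖ ^ 2 ≤ ∑ _j : J, (1 : ℝ) := Finset.sum_le_sum fun j _ => by
            rw [Real.norm_eq_abs, sq_abs]; nlinarith [(hθ j).1, (hθ j).2]
        _ = _ := by simp
    have hpt : ∀ X, ∑ j, 2 * θ j * τ θ j - 2 * √(Fintype.card J) * ∫ y, ‖φ y - τ θ‖ ∂(M X)
        ≤ ∑ j, 2 * θ j * g j X := by
      intro X
      have e1 : ∑ j, 2 * θ j * g j X = ∫ y, ∑ j, 2 * θ j * φ y j ∂(M X) := by
        rw [integral_finsetSum _ fun j _ => (hφi X j).const_mul _]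
        simp only [integral_const_mul, g]
      have e2 : ∑ j, 2 * θ j * τ θ j - 2 * √(Fintype.card J) * ∫ y, ‖φ y - τ θ‖ ∂(M X)
          = ∫ y, (∑ j, 2 * θ j * τ θ j - 2 * √(Fintype.card J) * ‖φ y - τ θ‖) ∂(M X) := by
        rw [integral_sub (integrable_const _) ((hdi θ hθ X).const_mul _), integral_const_mul]
        simp
      rw [e1, e2]
      refine integral_mono ((integrable_const _).sub ((hdi θ hθ X).const_mul _))
        (integrable_finsetSum _ fun j _ => (hφi X j).const_mul _) fun y => ?_
      -- Cauchy–Schwarz with `‖θ‖ ≤ √|J|` on the cube bounds the loss caused by the estimation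
      -- error.
      have hc := abs_le.1 (abs_real_inner_le_norm (WithLp.toLp 2 θ : EuclideanSpace ℝ J)
        (φ y - τ θ))
      have hc' := mul_le_mul_of_nonneg_right hθn (norm_nonneg (φ y - τ θ))
      have hin : inner ℝ (WithLp.toLp 2 θ : EuclideanSpace ℝ J) (φ y - τ θ)
          = ∑ j, θ j * φ y j - ∑ j, θ j * τ θ j := by
        simp only [PiLp.inner_apply, RCLike.inner_apply, conj_trivial, PiLp.sub_apply,
          ← Finset.sum_sub_distrib]
        exact Finset.sum_congr rfl fun j _ => by ring
      simp only [mul_assoc, ← Finset.mul_sum]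
      linarith [hc.1]
    have e3 : ∑ j, 2 * θ j * ∫ X, g j X * m.pdfN θ X ∂(Measure.pi fun _ : Fin n => m.base)
        = ∫ X, ∑ j, 2 * θ j * g j X ∂(Measure.pi fun _ : Fin n => m.law θ) := by
      rw [integral_finsetSum _ fun j _ => (hgi θ j).const_mul _]
      refine Finset.sum_congr rfl fun j _ => ?_
      rw [integral_const_mul, integral_pi_law]
      simp only [mul_comm]
    have e4 : ∑ j, 2 * θ j * τ θ j - 2 * √(Fintype.card J) * err θ
        = ∫ X, (∑ j, 2 * θ j * τ θ j - 2 * √(Fintype.card J) * ∫ y, ‖φ y - τ θ‖ ∂(M X))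
          ∂(Measure.pi fun _ : Fin n => m.law θ) := by
      rw [integral_sub (integrable_const _) ((hdXi θ hθ).const_mul _), integral_const_mul]
      simp [err]
    rw [e3, e4]
    exact integral_mono ((integrable_const _).sub ((hdXi θ hθ).const_mul _))
      (integrable_finsetSum _ fun j _ => (hgi θ j).const_mul _) hpt
  -- integrate over the prior
  have hτi : Integrable (fun θ => ∑ j, 2 * θ j * τ θ j) (cubeMeasure J) := by
    refine integrable_finsetSum _ fun j _ => ?_
    refine Integrable.of_bound (C := 2 * (K + R)) ((measurable_const.mul
      (measurable_pi_apply j)).mul ((hcoord j).comp hτ)).aestronglyMeasurable ?_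
    filter_upwards [ae_cubeMeasure_mem J] with θ hθ
    obtain ⟨X⟩ := nonempty_of_isProbabilityMeasure (Measure.pi fun _ : Fin n => m.law θ)
    obtain ⟨y⟩ := nonempty_of_isProbabilityMeasure (M X)
    have h1 : |τ θ j| ≤ K + R := by
      refine (PiLp.norm_apply_le (τ θ) j).trans ?_
      have := norm_sub_norm_le (τ θ) (φ y)
      rw [norm_sub_rev] at this
      linarith [hR θ hθ y, hφK y]
    rw [Real.norm_eq_abs, abs_mul, abs_mul, abs_of_pos (zero_lt_two' ℝ), mul_assoc]
    have h2 : |θ j| ≤ 1 := abs_le.2 (hθ j)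
    have := mul_le_mul h2 h1 (abs_nonneg _) zero_le_one
    linarith
  have hwi : ∀ j, Integrable (fun θ : J → ℝ => (1 - θ j ^ 2) *
      ∫ X, g j X * m.derivN j θ X ∂(Measure.pi fun _ : Fin n => m.base)) (cubeMeasure J) := by
    intro j
    refine Integrable.bdd_mul (c := 1) ?_ ((measurable_const.sub
      ((measurable_pi_apply j).pow_const 2)).aestronglyMeasurable) ?_
    · exact ((m.integrable_derivN_prod n j).bdd_mul (c := K)
        ((hg j).comp measurable_snd).aestronglyMeasurable
        (Filter.Eventually.of_forall fun r => hgK j r.2)).integral_prod_left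
    · filter_upwards [ae_cubeMeasure_mem J] with θ hθ
      rw [Real.norm_eq_abs, abs_le]
      constructor <;> nlinarith [(hθ j).1, (hθ j).2]
  have hti : ∀ j, Integrable (fun θ : J → ℝ => 2 * θ j *
      ∫ X, g j X * m.pdfN θ X ∂(Measure.pi fun _ : Fin n => m.base)) (cubeMeasure J) := by
    intro j
    refine Integrable.bdd_mul (c := 2) ?_ ((measurable_const.mul
      (measurable_pi_apply j)).aestronglyMeasurable) ?_
    · exact ((m.integrable_pdfN_prod n).bdd_mul (c := K)
        ((hg j).comp measurable_snd).aestronglyMeasurable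
        (Filter.Eventually.of_forall fun r => hgK j r.2)).integral_prod_left
    · filter_upwards [ae_cubeMeasure_mem J] with θ hθ
      rw [Real.norm_eq_abs, abs_le]
      constructor <;> linarith [(hθ j).1, (hθ j).2]
  -- This identity joins the two sides: the left is bounded above by privacy, the right below by
  -- accuracy.
  have hibp : ∫ θ, ∑ j, (1 - θ j ^ 2) *
        ∫ X, g j X * m.derivN j θ X ∂(Measure.pi fun _ : Fin n => m.base) ∂cubeMeasure J
      = ∫ θ, ∑ j, 2 * θ j *
        ∫ X, g j X * m.pdfN θ X ∂(Measure.pi fun _ : Fin n => m.base) ∂cubeMeasure J := by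
    rw [integral_finsetSum _ fun j _ => hwi j, integral_finsetSum _ fun j _ => hti j]
    exact Finset.sum_congr rfl fun j _ => integral_weight_mul_integral_deriv _ j
      (m.hasDerivAt_pdfN j) (m.continuous_derivN j) (m.integrable_derivN_prod n j)
      (m.integrable_pdfN_prod n) (hg j) (hgK j)
  have hlow := integral_mono_ae (hτi.sub (herr.const_mul (2 * √(Fintype.card J))))
    (integrable_finsetSum _ fun j _ => hti j)
    ((ae_cubeMeasure_mem J).mono fun θ hθ => hL θ hθ)
  have hup := integral_mono_ae (integrable_finsetSum _ fun j _ => hwi j)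
    (((herr.const_mul (2 * ε * m.σ)).add (integrable_const (2 * δ * R * m.κ))).const_mul (n : ℝ))
    ((ae_cubeMeasure_mem J).mono fun θ hθ => hU θ hθ)
  have ee : ∫ θ, err θ ∂cubeMeasure J = e := he.symm
  rw [integral_sub' hτi (herr.const_mul _), integral_const_mul, ee, ← hibp] at hlow
  refine hlow.trans (hup.trans_eq ?_)
  rw [integral_const_mul, integral_add' (herr.const_mul _) (integrable_const _),
    integral_const_mul, ee]
  simp

end ScoreModel

/-! ### Frobenius and Mahalanobis errors -/

lemma frobNorm_nonneg {d : ℕ} (A : Matrix (Fin d) (Fin d) ℝ) : 0 ≤ frobNorm A :=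
  Real.sqrt_nonneg _

lemma trace_transpose_mul_self {d : ℕ} (A : Matrix (Fin d) (Fin d) ℝ) :
    (A.transpose * A).trace = ∑ i, ∑ j, A i j ^ 2 := by
  rw [Finset.sum_comm]
  simp [Matrix.trace, Matrix.mul_apply, sq]

lemma frobNorm_sq {d : ℕ} (A : Matrix (Fin d) (Fin d) ℝ) :
    frobNorm A ^ 2 = (A.transpose * A).trace := by
  rw [frobNorm, Real.sq_sqrt]
  rw [trace_transpose_mul_self]
  positivity

lemma frobNorm_sq_eq_sum {d : ℕ} (A : Matrix (Fin d) (Fin d) ℝ) :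
    frobNorm A ^ 2 = ∑ i, ∑ j, A i j ^ 2 := by
  rw [frobNorm_sq, trace_transpose_mul_self]

lemma frobNorm_transpose {d : ℕ} (A : Matrix (Fin d) (Fin d) ℝ) :
    frobNorm A.transpose = frobNorm A := by
  rw [frobNorm, frobNorm, Matrix.transpose_transpose, Matrix.trace_mul_comm]

lemma measurable_matrix_apply {d : ℕ} (i j : Fin d) :
    Measurable fun A : Matrix (Fin d) (Fin d) ℝ => A i j :=
  (measurable_pi_apply j).comp
    (measurable_pi_apply (X := fun _ : Fin d => Fin d → ℝ) i)

lemma measurable_frobNorm_sub_sq {d : ℕ} (S : Matrix (Fin d) (Fin d) ℝ) :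
    Measurable fun A => frobNorm (A - S) ^ 2 := by
  simp only [frobNorm_sq_eq_sum, Matrix.sub_apply]
  exact Finset.measurable_sum _ fun i _ => Finset.measurable_sum _ fun j _ =>
    ((measurable_matrix_apply i j).sub_const _).pow_const 2

/-- Multiplying by a symmetric matrix whose square is at most `2` increases the Frobenius norm by
at most the factor `√2`. -/
lemma frobNorm_mul_sq_le {d : ℕ} {S : Matrix (Fin d) (Fin d) ℝ} (hS : S.transpose = S)
    (h2 : S * S ≤ (2 : ℝ) • 1) (C : Matrix (Fin d) (Fin d) ℝ) :
    frobNorm (S * C) ^ 2 ≤ 2 * frobNorm C ^ 2 := by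
  rw [frobNorm_sq, frobNorm_sq, Matrix.transpose_mul, hS]
  have hp : ((2 : ℝ) • 1 - S * S).PosSemidef := Matrix.le_iff.1 h2
  have := (hp.conjTranspose_mul_mul_same C).trace_nonneg
  rw [Matrix.conjTranspose_eq_transpose_of_trivial, Matrix.mul_sub, Matrix.sub_mul,
    Matrix.trace_sub] at this
  simp only [Matrix.mul_smul, Matrix.smul_mul, Matrix.mul_one, Matrix.trace_smul,
    smul_eq_mul] at this
  simp only [Matrix.mul_assoc] at this ⊢
  linarith

/-- With `S = √Σ` one has `A = S * C * S`, where `C` has Frobenius norm `mahaNorm Sig A`. Each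
factor `S` costs `√2` since `S * S ≤ 2`; the right-hand factor is treated by transposing. The bound
`1 ≤ Sig` makes `S` invertible. -/
lemma frobNorm_le_two_mul_mahaNorm {d : ℕ} {Sig : Matrix (Fin d) (Fin d) ℝ}
    (h1 : 1 ≤ Sig) (h2 : Sig ≤ (2 : ℝ) • 1) (A : Matrix (Fin d) (Fin d) ℝ) :
    frobNorm A ≤ 2 * mahaNorm Sig A := by
  have h0 : 0 ≤ Sig := (Matrix.PosSemidef.one.nonneg).trans h1
  set S := CFC.sqrt Sig with hSdef
  have hSS : S * S = Sig := CFC.sqrt_mul_sqrt_self Sig h0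
  have hSt : S.transpose = S := by
    have : S.conjTranspose = S := (CFC.sqrt_nonneg Sig).isSelfAdjoint
    rwa [Matrix.conjTranspose_eq_transpose_of_trivial] at this
  have hpd : Sig.PosDef := by
    have := Matrix.PosDef.one.add_posSemidef (Matrix.le_iff.1 h1)
    simpa using this
  have hdet : IsUnit S.det := by
    have := hpd.det_pos
    rw [← hSS, Matrix.det_mul] at this
    exact isUnit_iff_ne_zero.2 fun h => by simp [h] at this
  set C := S⁻¹ * A * S⁻¹ with hC
  have hA : A = S * (C * S) := by
    rw [hC]
    simp only [Matrix.mul_assoc, Matrix.nonsing_inv_mul _ hdet, Matrix.mul_one]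
    rw [← Matrix.mul_assoc, Matrix.mul_nonsing_inv _ hdet, Matrix.one_mul]
  have e1 := frobNorm_mul_sq_le hSt (hSS.trans_le h2) (C * S)
  have e2 := frobNorm_mul_sq_le hSt (hSS.trans_le h2) C.transpose
  rw [frobNorm_transpose, show S * C.transpose = (C * S).transpose by
    rw [Matrix.transpose_mul C S, hSt], frobNorm_transpose] at e2
  rw [← hA] at e1
  have : frobNorm A ^ 2 ≤ (2 * frobNorm C) ^ 2 := by nlinarith
  exact (pow_le_pow_iff_left₀ (frobNorm_nonneg _) (mul_nonneg zero_le_two (frobNorm_nonneg _))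
    two_ne_zero).1 this

/-- Under a prior on `[1, 2]`, Mahalanobis accuracy implies Frobenius accuracy. -/
lemma expectedSqError_frobNorm_le {d n : ℕ} {D : Measure (Matrix (Fin d) (Fin d) ℝ)}
    (hD : ∀ᵐ Sig ∂D, 1 ≤ Sig ∧ Sig ≤ (2 : ℝ) • 1)
    (M : Kernel (Fin n → EuclideanSpace ℝ (Fin d)) (Matrix (Fin d) (Fin d) ℝ)) :
    expectedSqError (fun _ A => frobNorm A) D M ≤ 4 * expectedSqError mahaNorm D M := by
  unfold expectedSqError
  rw [← lintegral_const_mul' _ _ (by norm_num)]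
  refine lintegral_mono_ae (hD.mono fun Sig hS => ?_)
  rw [← lintegral_const_mul' _ _ (by norm_num)]
  refine lintegral_mono fun X => ?_
  rw [← lintegral_const_mul' _ _ (by norm_num)]
  refine lintegral_mono fun A => ?_
  have h4 : (4 : ENNReal) = ENNReal.ofReal 4 := by norm_num
  simp only
  rw [h4, ← ENNReal.ofReal_mul (by norm_num)]
  refine ENNReal.ofReal_le_ofReal ?_
  have := pow_le_pow_left₀ (frobNorm_nonneg _) (frobNorm_le_two_mul_mahaNorm hS.1 hS.2 (A - Sig)) 2
  linarith

/-- Jensen's inequality for iterated integrals: a bound on the mean square bounds the mean. -/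
lemma integral_integral_integral_norm_le {Θ 𝒳 𝒴 E : Type*} [MeasurableSpace Θ] [MeasurableSpace 𝒳]
    [MeasurableSpace 𝒴] [NormedAddCommGroup E] (D : Measure Θ) [IsProbabilityMeasure D]
    (P : Θ → Measure 𝒳) [∀ θ, IsProbabilityMeasure (P θ)]
    (M : 𝒳 → Measure 𝒴) [∀ x, IsProbabilityMeasure (M x)] (f : Θ → 𝒴 → E) {β : ℝ} (hβ : 0 ≤ β)
    (h : ∫⁻ θ, ∫⁻ X, ∫⁻ y, ENNReal.ofReal (‖f θ y‖ ^ 2) ∂(M X) ∂(P θ) ∂D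
      ≤ ENNReal.ofReal (β ^ 2)) :
    ∫ θ, ∫ X, ∫ y, ‖f θ y‖ ∂(M X) ∂(P θ) ∂D ≤ β := by
  -- The pointwise inequality `x ≤ (x ^ 2 / c + c) / 2` replaces Jensen and requires no
  -- measurability of `f`. The choice `c = β` is optimal; for `β = 0` one lets `c` tend to zero.
  have key : ∀ c : ℝ, 0 < c →
      ∫ θ, ∫ X, ∫ y, ‖f θ y‖ ∂(M X) ∂(P θ) ∂D ≤ (β ^ 2 / c + c) / 2 := by
    intro c hc
    have h1 : ‖∫ θ, ∫ X, ∫ y, ‖f θ y‖ ∂(M X) ∂(P θ) ∂D‖ₑ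
        ≤ ∫⁻ θ, ∫⁻ X, ∫⁻ y, ‖‖f θ y‖‖ₑ ∂(M X) ∂(P θ) ∂D := by
      refine (enorm_integral_le_lintegral_enorm _).trans (lintegral_mono fun θ => ?_)
      refine (enorm_integral_le_lintegral_enorm _).trans (lintegral_mono fun X => ?_)
      exact enorm_integral_le_lintegral_enorm _
    have h2 : ∫⁻ θ, ∫⁻ X, ∫⁻ y, ‖‖f θ y‖‖ₑ ∂(M X) ∂(P θ) ∂D
        ≤ ∫⁻ θ, ∫⁻ X, ∫⁻ y, (ENNReal.ofReal (1 / (2 * c)) * ENNReal.ofReal (‖f θ y‖ ^ 2)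
          + ENNReal.ofReal (c / 2)) ∂(M X) ∂(P θ) ∂D := by
      refine lintegral_mono fun θ => lintegral_mono fun X => lintegral_mono fun y => ?_
      rw [← ENNReal.ofReal_mul (by positivity), ← ENNReal.ofReal_add (by positivity)
        (by positivity), Real.enorm_eq_ofReal (norm_nonneg _)]
      refine ENNReal.ofReal_le_ofReal ?_
      have : 1 / (2 * c) * ‖f θ y‖ ^ 2 + c / 2 - ‖f θ y‖ = (‖f θ y‖ - c) ^ 2 / (2 * c) := by
        field_simp; ring
      have h0 : 0 ≤ (‖f θ y‖ - c) ^ 2 / (2 * c) := by positivity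
      linarith
    have h3 : ∫⁻ θ, ∫⁻ X, ∫⁻ y, (ENNReal.ofReal (1 / (2 * c)) * ENNReal.ofReal (‖f θ y‖ ^ 2)
          + ENNReal.ofReal (c / 2)) ∂(M X) ∂(P θ) ∂D
        = ENNReal.ofReal (1 / (2 * c)) *
            (∫⁻ θ, ∫⁻ X, ∫⁻ y, ENNReal.ofReal (‖f θ y‖ ^ 2) ∂(M X) ∂(P θ) ∂D)
          + ENNReal.ofReal (c / 2) := by
      simp only [lintegral_add_right _ measurable_const,
        lintegral_const_mul' _ _ ENNReal.ofReal_ne_top, lintegral_const, measure_univ, mul_one]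
    rw [h3] at h2
    have h4 := h1.trans (h2.trans (add_le_add_left (mul_le_mul_right h _) _))
    rw [← ENNReal.ofReal_mul (by positivity), ← ENNReal.ofReal_add (by positivity) (by positivity),
      Real.enorm_eq_ofReal_abs, ENNReal.ofReal_le_ofReal_iff (by positivity)] at h4
    refine (le_abs_self _).trans (h4.trans_eq ?_)
    field_simp
  rcases hβ.eq_or_lt with h0 | h0
  · refine le_of_forall_pos_le_add fun η hη => ?_
    have := key η hη
    rw [← h0] at this ⊢
    simp at this
    linarith
  · have := key β h0
    rw [sq, mul_div_assoc, div_self h0.ne'] at this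
    linarith

/-! ### From score models to covariance estimation -/

/-- Injective measurable parametrizations of matrices are measurable embeddings. -/
lemma measurableEmbedding_matrix {J : Type*} [Fintype J] {d : ℕ}
    {Sg : (J → ℝ) → Matrix (Fin d) (Fin d) ℝ} (hSg : Measurable Sg)
    (hSg_inj : Function.Injective Sg) : MeasurableEmbedding Sg := by
  have : MeasurableSpace.CountablySeparated (Matrix (Fin d) (Fin d) ℝ) :=
    inferInstanceAs (MeasurableSpace.CountablySeparated (Fin d → Fin d → ℝ))
  exact hSg.measurableEmbedding hSg_inj

namespace ScoreModel

/-- The fingerprinting bound for private covariance estimation, when the Gaussian samples are the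
images of the samples of a score model and the parameter is read off from entries of the output. -/
theorem covariance_bound {J 𝒳 : Type*} [Fintype J] [DecidableEq J] [MeasurableSpace 𝒳]
    (m : ScoreModel J 𝒳) {d n : ℕ} {T : 𝒳 → EuclideanSpace ℝ (Fin d)} (hT : Measurable T)
    {Sg : (J → ℝ) → Matrix (Fin d) (Fin d) ℝ} (hSg : Measurable Sg)
    (hSg_inj : Function.Injective Sg)
    (hlaw : ∀ θ, (m.law θ).map T = multivariateGaussian 0 (Sg θ))
    {ex : Matrix (Fin d) (Fin d) ℝ → EuclideanSpace ℝ J} (hex : Measurable ex)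
    (hex_le : ∀ A B, ‖ex A - ex B‖ ≤ frobNorm (A - B))
    {c : EuclideanSpace ℝ J} {r : ℝ}
    (hr : ∀ θ : J → ℝ, (∀ j, θ j ∈ Set.Icc (-1 : ℝ) 1) → ‖ex (Sg θ) - c‖ ≤ r)
    (M : Kernel (Fin n → EuclideanSpace ℝ (Fin d)) (Matrix (Fin d) (Fin d) ℝ)) [IsMarkovKernel M]
    {ε δ β : ℝ} (hε : 0 ≤ ε) (hε1 : ε ≤ 1) (hδ : 0 ≤ δ) (hDP : IsDP ε δ M)
    (hσ : 0 ≤ m.σ) (hβ : 0 ≤ β)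
    (herr : expectedSqError (fun _ A => frobNorm A) ((cubeMeasure J).map Sg) M
      ≤ ENNReal.ofReal (β ^ 2)) :
    ∫ θ, ∑ j, 2 * θ j * ex (Sg θ) j ∂cubeMeasure J - 2 * √(Fintype.card J) * β
      ≤ n * (2 * ε * m.σ * β + 2 * δ * (3 * r) * m.κ) := by
  have hTn : Measurable fun (X : Fin n → 𝒳) i => T (X i) :=
    measurable_pi_lambda _ fun i => hT.comp (measurable_pi_apply i)
  let M' : Kernel (Fin n → 𝒳) (Matrix (Fin d) (Fin d) ℝ) := M.comap (fun X i => T (X i)) hTn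
  have hM' : IsMarkovKernel M' := inferInstanceAs (IsMarkovKernel (M.comap _ hTn))
  have hDP' : ∀ X i x S, MeasurableSet S → M' X S ≤
      ENNReal.ofReal (Real.exp ε) * M' (Function.update X i x) S + ENNReal.ofReal δ := by
    intro X i x S hS
    simp only [M', Kernel.comap_apply]
    -- Neighbouring datasets must really differ. If the images agree the two datasets are equal, and
    -- the bound holds because `exp ε ≥ 1`.
    by_cases h : T (X i) = T x
    · have : (fun j => T (Function.update X i x j)) = fun j => T (X j) := by
        ext1 j
        by_cases hj : j = i
        · subst hj; simp [h]
        · simp [hj]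
      rw [this]
      refine le_add_right ?_
      calc M (fun j => T (X j)) S = 1 * M (fun j => T (X j)) S := (one_mul _).symm
        _ ≤ _ := by
          gcongr
          exact ENNReal.one_le_ofReal.2 (Real.one_le_exp hε)
    · refine hDP _ _ ⟨i, by simpa using h, fun j hj => by simp [hj]⟩ S hS
  -- Outputs further than `2 * r` from the centre are replaced by the centre. This bounds the error
  -- by `3 * r` and never increases it: a discarded output was more than `r` away from the truth,
  -- while the centre is within `r`.
  let φ : Matrix (Fin d) (Fin d) ℝ → EuclideanSpace ℝ J := fun y =>
    if ‖ex y - c‖ ≤ 2 * r then ex y else c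
  have hφ : Measurable φ := Measurable.ite
    (measurableSet_le (hex.sub_const c).norm measurable_const) hex measurable_const
  have hr0 : 0 ≤ r := (norm_nonneg _).trans (hr 0 fun j => by simp)
  have hR : ∀ θ : J → ℝ, (∀ j, θ j ∈ Set.Icc (-1 : ℝ) 1) → ∀ y, ‖φ y - ex (Sg θ)‖ ≤ 3 * r := by
    intro θ hθ y
    have h1 := hr θ hθ
    have h2 := norm_sub_le_norm_sub_add_norm_sub (φ y) c (ex (Sg θ))
    rw [norm_sub_rev c] at h2
    have h3 : ‖φ y - c‖ ≤ 2 * r := by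
      simp only [φ]; split_ifs with h
      · exact h
      · simpa using hr0
    linarith
  have hφle : ∀ θ : J → ℝ, (∀ j, θ j ∈ Set.Icc (-1 : ℝ) 1) → ∀ y,
      ‖φ y - ex (Sg θ)‖ ≤ frobNorm (y - Sg θ) := by
    intro θ hθ y
    refine le_trans ?_ (hex_le y (Sg θ))
    simp only [φ]; split_ifs with h
    · exact le_rfl
    · have h1 := hr θ hθ
      have h2 := norm_sub_le_norm_sub_add_norm_sub (ex y) (ex (Sg θ)) c
      rw [norm_sub_rev c]
      linarith
  -- Along an embedding the outer integral can be pulled back to the cube without measurability of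
  -- the integrand in `Σ`.
  have hemb := measurableEmbedding_matrix hSg hSg_inj
  have hpi : ∀ θ, (Measure.pi fun _ : Fin n => multivariateGaussian 0 (Sg θ))
      = (Measure.pi fun _ : Fin n => m.law θ).map fun X i => T (X i) := by
    intro θ
    have hs : SigmaFinite ((m.law θ).map T) := by rw [hlaw]; infer_instance
    rw [Measure.pi_map_pi (μ := fun _ : Fin n => m.law θ) fun _ => hT.aemeasurable]
    simp only [hlaw]
  have hle : ∫ θ, ∫ X, ∫ y, ‖φ y - ex (Sg θ)‖ ∂(M' X) ∂(Measure.pi fun _ => m.law θ)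
      ∂cubeMeasure J ≤ β := by
    refine integral_integral_integral_norm_le (cubeMeasure J)
      (fun θ => Measure.pi fun _ : Fin n => m.law θ) (fun X => M' X)
      (fun θ y => φ y - ex (Sg θ)) hβ (le_trans ?_ herr)
    unfold expectedSqError
    rw [hemb.lintegral_map]
    refine lintegral_mono_ae ((ae_cubeMeasure_mem J).mono fun θ hθ => ?_)
    rw [hpi θ, lintegral_map ((measurable_frobNorm_sub_sq (Sg θ)).ennreal_ofReal.lintegral_kernel)
      hTn]
    refine lintegral_mono fun X => lintegral_mono fun y => ENNReal.ofReal_le_ofReal ?_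
    exact pow_le_pow_left₀ (norm_nonneg _) (hφle θ hθ y) 2
  have hb := m.fingerprinting_bound M' hε hε1 hδ hDP' hφ (hex.comp hSg) hR rfl
  simp only [Function.comp] at hb
  have h1 := mul_le_mul_of_nonneg_left hle
    (mul_nonneg zero_le_two (Real.sqrt_nonneg (Fintype.card J : ℝ)))
  have h2 := mul_le_mul_of_nonneg_left hle (mul_nonneg (mul_nonneg zero_le_two hε) hσ)
  have h3 := mul_le_mul_of_nonneg_left h2 (Nat.cast_nonneg (α := ℝ) n)
  rw [mul_add] at hb ⊢
  linarith

end ScoreModel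

/-! ### Gaussian moments and the regression model -/

/-- The variance of `|f|` is nonnegative. -/
lemma integral_abs_le_of_integral_sq_le {Ω : Type*} [MeasurableSpace Ω] {μ : Measure Ω}
    [IsProbabilityMeasure μ] {f : Ω → ℝ} (hf : MemLp f 2 μ) {c : ℝ} (hc : 0 ≤ c)
    (h : ∫ x, f x ^ 2 ∂μ ≤ c ^ 2) : ∫ x, |f x| ∂μ ≤ c := by
  have h1 := variance_nonneg |f| μ
  rw [variance_eq_sub hf.abs] at h1
  simp only [Pi.pow_apply, Pi.abs_apply, sq_abs] at h1
  exact (pow_le_pow_iff_left₀ (integral_nonneg fun _ => abs_nonneg _) hc two_ne_zero).1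
    (by linarith)

/-- Pushing forward along a measure-preserving map turns a pulled back density into the density. -/
lemma map_withDensity_comp {α β : Type*} [MeasurableSpace α] [MeasurableSpace β] {μ : Measure α}
    {ν : Measure β} {T : α → β} (hT : MeasurePreserving T μ ν) {f : β → ENNReal}
    (hf : Measurable f) : (μ.withDensity (f ∘ T)).map T = ν.withDensity f := by
  ext s hs
  rw [Measure.map_apply hT.measurable hs, withDensity_apply _ (hT.measurable hs),
    withDensity_apply _ hs]
  exact hT.setLIntegral_comp_preimage hs hf

lemma hasDerivAt_gaussianPDFReal (y : ℝ) :
    HasDerivAt (gaussianPDFReal 0 1) (-y * gaussianPDFReal 0 1 y) y := by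
  rw [gaussianPDFReal_def]
  have h1 : HasDerivAt (fun x : ℝ => -(x - 0) ^ 2 / (2 * ((1 : NNReal) : ℝ))) (-y) y := by
    have := ((((hasDerivAt_id y).sub_const 0).pow 2).neg).div_const (2 * ((1 : NNReal) : ℝ))
    refine this.congr_deriv ?_
    simp; ring
  refine (h1.exp.const_mul _).congr_deriv ?_
  ring

/-- The standard Gaussian law on `ι → ℝ`. -/
noncomputable def gaussPi (ι : Type*) [Fintype ι] : Measure (ι → ℝ) :=
  Measure.pi fun _ => gaussianReal 0 1

instance (ι : Type*) [Fintype ι] : IsProbabilityMeasure (gaussPi ι) :=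
  inferInstanceAs (IsProbabilityMeasure (Measure.pi fun _ => gaussianReal 0 1))

lemma gaussPi_eq_withDensity (ι : Type*) [Fintype ι] :
    gaussPi ι = (volume : Measure (ι → ℝ)).withDensity
      fun z => ENNReal.ofReal (∏ i, gaussianPDFReal 0 1 (z i)) := by
  rw [volume_pi, ← pi_withDensity_ofReal volume (gaussianPDFReal 0 1)
    (gaussianPDFReal_nonneg 0 1) (integrable_gaussianPDFReal 0 1), gaussPi,
    gaussianReal_of_var_ne_zero 0 one_ne_zero]
  rfl

lemma memLp_coord_gaussPi {ι : Type*} [Fintype ι] (i : ι) :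
    MemLp (fun z : ι → ℝ => z i) 2 (gaussPi ι) :=
  (memLp_id_gaussianReal 2).comp_measurePreserving
    (measurePreserving_eval (fun _ : ι => gaussianReal 0 1) i)

lemma integral_coord_gaussPi {ι : Type*} [Fintype ι] (i : ι) :
    ∫ z, z i ∂gaussPi ι = 0 := by
  have := integral_comp_eval (μ := fun _ : ι => gaussianReal 0 1) (i := i) (f := fun x : ℝ => x)
    aestronglyMeasurable_id
  exact this.trans integral_id_gaussianReal

lemma integral_sum_mul_coord_sq {ι : Type*} [Fintype ι] (c : ι → ℝ) :
    ∫ z, (∑ i, c i * z i) ^ 2 ∂gaussPi ι = ∑ i, c i ^ 2 := by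
  have h0 : ∫ z, ∑ i, c i * z i ∂gaussPi ι = 0 := by
    rw [integral_finsetSum _ fun i _ =>
      ((memLp_coord_gaussPi i).integrable one_le_two).const_mul _]
    simp [integral_const_mul, integral_coord_gaussPi]
  have hm : Measurable fun z : ι → ℝ => ∑ i, c i * z i := by fun_prop
  rw [← variance_of_integral_eq_zero hm.aemeasurable h0]
  have : (fun z : ι → ℝ => ∑ i, c i * z i) = ∑ i, (fun z : ι → ℝ => (fun x => c i * x) (z i)) := by
    ext z; simp
  rw [this, gaussPi, variance_sum_pi]
  · refine Finset.sum_congr rfl fun i _ => ?_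
    rw [variance_const_mul, variance_fun_id_gaussianReal]
    simp
  · exact fun i => (memLp_id_gaussianReal 2).const_mul _

section Regression

set_option linter.unusedSectionVars false

variable {K L : Type*} [Fintype K] [Fintype L]

/-- The outer product of two independent Gaussian vectors. -/
noncomputable def outer (q : (K → ℝ) × (L → ℝ)) : EuclideanSpace ℝ (L × K) :=
  WithLp.toLp 2 fun p => q.2 p.1 * q.1 p.2

lemma measurable_outer : Measurable (outer : (K → ℝ) × (L → ℝ) → EuclideanSpace ℝ (L × K)) := by
  refine (WithLp.measurable_toLp 2 (L × K → ℝ)).comp (measurable_pi_lambda _ fun p => ?_)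
  fun_prop

lemma memLp_outer_apply (p : L × K) :
    MemLp (fun q : (K → ℝ) × (L → ℝ) => outer q p) 2 ((gaussPi K).prod (gaussPi L)) := by
  have hm : Measurable fun q : (K → ℝ) × (L → ℝ) => outer q p := by
    simp only [outer]; fun_prop
  rw [memLp_two_iff_integrable_sq hm.aestronglyMeasurable]
  have := (memLp_coord_gaussPi p.2).integrable_sq.mul_prod (memLp_coord_gaussPi p.1).integrable_sq
  refine this.congr (Filter.Eventually.of_forall fun q => ?_)
  simp only [outer]; ring

lemma integral_outer_apply (p : L × K) :
    ∫ q : (K → ℝ) × (L → ℝ), outer q p ∂(gaussPi K).prod (gaussPi L) = 0 := by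
  have := integral_prod_mul (μ := gaussPi K) (ν := gaussPi L) (fun u => u p.2) (fun z => z p.1)
  rw [integral_coord_gaussPi, zero_mul] at this
  rw [← this]
  simp only [outer, mul_comm]

lemma integrable_outer :
    Integrable (outer : (K → ℝ) × (L → ℝ) → EuclideanSpace ℝ (L × K))
      ((gaussPi K).prod (gaussPi L)) :=
  Integrable.of_eval_piLp fun p => (memLp_outer_apply p).integrable one_le_two

lemma integral_outer :
    ∫ q : (K → ℝ) × (L → ℝ), outer q ∂(gaussPi K).prod (gaussPi L) = 0 := by
  ext p
  have := (EuclideanSpace.proj (𝕜 := ℝ) p).integral_comp_comm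
    (integrable_outer (K := K) (L := L))
  exact this.symm.trans (integral_outer_apply p)

lemma memLp_inner_outer (a : EuclideanSpace ℝ (L × K)) :
    MemLp (fun q : (K → ℝ) × (L → ℝ) => inner ℝ a (outer q)) 2
      ((gaussPi K).prod (gaussPi L)) := by
  simp only [PiLp.inner_apply, RCLike.inner_apply, conj_trivial]
  exact memLp_finsetSum _ fun p _ => (memLp_outer_apply p).mul_const _

/-- For fixed covariates the inner product is a linear form in the noise, whose second moment is the
sum of the squared coefficients. These are linear in the covariates, and the same formula applies
again. Thus the outer product has identity covariance, and the directional bound `σ` carries no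
dimension factor. -/
lemma integral_inner_outer_sq (a : EuclideanSpace ℝ (L × K)) :
    ∫ q : (K → ℝ) × (L → ℝ), inner ℝ a (outer q) ^ 2 ∂(gaussPi K).prod (gaussPi L)
      = ‖a‖ ^ 2 := by
  rw [integral_prod _ (memLp_inner_outer a).integrable_sq]
  have h1 : ∀ (u : K → ℝ) (z : L → ℝ),
      inner ℝ a (outer (u, z)) = ∑ i, (∑ j, a (i, j) * u j) * z i := by
    intro u z
    simp only [PiLp.inner_apply, RCLike.inner_apply, conj_trivial, outer, Fintype.sum_prod_type,
      Finset.sum_mul]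
    exact Finset.sum_congr rfl fun i _ => Finset.sum_congr rfl fun j _ => by ring
  simp only [h1, integral_sum_mul_coord_sq]
  rw [integral_finsetSum]
  · simp only [integral_sum_mul_coord_sq]
    rw [EuclideanSpace.norm_sq_eq, Fintype.sum_prod_type]
    simp
  · intro i _
    have : MemLp (fun u : K → ℝ => ∑ j, a (i, j) * u j) 2 (gaussPi K) :=
      memLp_finsetSum _ fun j _ => (memLp_coord_gaussPi j).const_mul _
    exact this.integrable_sq

lemma integral_abs_inner_outer_le (a : EuclideanSpace ℝ (L × K)) :
    ∫ q : (K → ℝ) × (L → ℝ), |inner ℝ a (outer q)| ∂(gaussPi K).prod (gaussPi L) ≤ ‖a‖ :=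
  integral_abs_le_of_integral_sq_le (memLp_inner_outer a) (norm_nonneg a)
    (integral_inner_outer_sq a).le

lemma integral_norm_outer_le :
    ∫ q : (K → ℝ) × (L → ℝ), ‖outer q‖ ∂(gaussPi K).prod (gaussPi L)
      ≤ √(Fintype.card (L × K)) := by
  classical
  have h := integral_abs_le_of_integral_sq_le (μ := (gaussPi K).prod (gaussPi L))
    (f := fun q : (K → ℝ) × (L → ℝ) => ‖outer q‖) (c := √(Fintype.card (L × K)))
  have hs : ∀ q : (K → ℝ) × (L → ℝ), ‖outer q‖ ^ 2 = ∑ p, outer q p ^ 2 := fun q => by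
    rw [EuclideanSpace.norm_sq_eq]; simp
  have hi : Integrable (fun q : (K → ℝ) × (L → ℝ) => ‖outer q‖ ^ 2)
      ((gaussPi K).prod (gaussPi L)) := by
    simp only [hs]
    exact integrable_finsetSum _ fun p _ => (memLp_outer_apply p).integrable_sq
  simp only [abs_norm] at h
  refine h ?_ (Real.sqrt_nonneg _) ?_
  · rw [memLp_two_iff_integrable_sq measurable_outer.norm.aestronglyMeasurable]
    exact hi
  · rw [Real.sq_sqrt (Nat.cast_nonneg _)]
    simp only [hs]
    rw [integral_finsetSum _ fun p _ => (memLp_outer_apply p).integrable_sq]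
    have : ∀ p : L × K, ∫ q : (K → ℝ) × (L → ℝ), outer q p ^ 2 ∂(gaussPi K).prod (gaussPi L)
        = 1 := fun p => by
      have := integral_inner_outer_sq (EuclideanSpace.single p (1 : ℝ))
      simpa [EuclideanSpace.inner_single_left] using this
    simp [this]

/-- The conditional mean `ρ θ u` of the response given the covariates. -/
noncomputable def regMean (ρ : ℝ) (θ : L × K → ℝ) (u : K → ℝ) : L → ℝ :=
  fun i => ρ * ∑ j, θ (i, j) * u j

/-- The map taking covariates and noise to covariates and responses. -/
noncomputable def regMap (ρ : ℝ) (θ : L × K → ℝ) (q : (K → ℝ) × (L → ℝ)) :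
    (K → ℝ) × (L → ℝ) := (q.1, q.2 + regMean ρ θ q.1)

lemma measurable_regMean (ρ : ℝ) :
    Measurable fun q : (L × K → ℝ) × (K → ℝ) => regMean ρ q.1 q.2 := by
  refine measurable_pi_lambda _ fun i => ?_
  unfold regMean; fun_prop

/-- The map is a shear: for fixed covariates it translates the response, which preserves Lebesgue
measure. -/
lemma measurePreserving_regMap (ρ : ℝ) (θ : L × K → ℝ) :
    MeasurePreserving (regMap ρ θ) ((gaussPi K).prod volume) ((gaussPi K).prod volume) := by
  have hm : Measurable (regMean ρ θ) :=
    (measurable_regMean ρ).comp (measurable_const.prodMk measurable_id)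
  refine (MeasurePreserving.id (gaussPi K)).skew_product (g := fun u z => z + regMean ρ θ u)
    (measurable_snd.add (hm.comp measurable_fst)) (Filter.Eventually.of_forall fun u => ?_)
  exact (measurePreserving_add_right volume _).map_eq

/-- The density of covariates and responses. -/
noncomputable def regPdf (ρ : ℝ) (θ : L × K → ℝ) (q : (K → ℝ) × (L → ℝ)) : ℝ :=
  ∏ i, gaussianPDFReal 0 1 (q.2 i - regMean ρ θ q.1 i)

lemma measurable_regPdf (ρ : ℝ) :
    Measurable (Function.uncurry (regPdf ρ : (L × K → ℝ) → (K → ℝ) × (L → ℝ) → ℝ)) := by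
  refine Finset.measurable_prod _ fun i _ => (measurable_gaussianPDFReal 0 1).comp ?_
  refine Measurable.sub (by fun_prop) ?_
  exact (measurable_pi_apply i).comp ((measurable_regMean ρ).comp
    (measurable_fst.prodMk (measurable_fst.comp measurable_snd)))

lemma measurable_regPdf_right (ρ : ℝ) (θ : L × K → ℝ) : Measurable (regPdf ρ θ) :=
  (measurable_regPdf ρ).of_uncurry_left

/-- The regression law is the image of parameter-free Gaussian noise, so all moments of the score
can be computed in the noise coordinates. -/
lemma map_regMap (ρ : ℝ) (θ : L × K → ℝ) :
    ((gaussPi K).prod (gaussPi L)).map (regMap ρ θ)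
      = ((gaussPi K).prod volume).withDensity fun q => ENNReal.ofReal (regPdf ρ θ q) := by
  rw [gaussPi_eq_withDensity L, prod_withDensity_right (by fun_prop)]
  rw [← map_withDensity_comp (measurePreserving_regMap ρ θ)
    (measurable_regPdf_right ρ θ).ennreal_ofReal]
  congr 2
  ext q
  simp [regPdf, regMap]

/-- The score is the outer product of the residual with the covariates. -/
noncomputable def regScore (ρ : ℝ) (θ : L × K → ℝ) (q : (K → ℝ) × (L → ℝ)) :
    EuclideanSpace ℝ (L × K) := ρ • outer (q.1, q.2 - regMean ρ θ q.1)

/-- In noise coordinates the residual is the noise itself. The law of the score therefore does not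
depend on `θ`. -/
lemma regScore_regMap (ρ : ℝ) (θ : L × K → ℝ) (q : (K → ℝ) × (L → ℝ)) :
    regScore ρ θ (regMap ρ θ q) = ρ • outer q := by
  simp [regScore, regMap]

lemma measurable_regScore (ρ : ℝ) :
    Measurable (Function.uncurry
      (regScore ρ : (L × K → ℝ) → (K → ℝ) × (L → ℝ) → EuclideanSpace ℝ (L × K))) := by
  refine (measurable_outer.comp ?_).const_smul ρ
  refine Measurable.prodMk (measurable_fst.comp measurable_snd) ?_
  exact (measurable_snd.comp measurable_snd).sub ((measurable_regMean ρ).comp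
    (measurable_fst.prodMk (measurable_fst.comp measurable_snd)))

lemma measurable_regScore_right (ρ : ℝ) (θ : L × K → ℝ) : Measurable (regScore ρ θ) :=
  (measurable_regScore ρ).of_uncurry_left

lemma hasDerivAt_regMean [DecidableEq K] [DecidableEq L] (ρ : ℝ) (θ : L × K → ℝ) (u : K → ℝ)
    (p : L × K) (i : L) (t : ℝ) :
    HasDerivAt (fun t => regMean ρ (Function.update θ p t) u i)
      (if i = p.1 then ρ * u p.2 else 0) t := by
  have h1 : ∀ r : L × K, HasDerivAt (fun t => Function.update θ p t r)
      ((Pi.single p 1 : L × K → ℝ) r) t := hasDerivAt_pi.1 (hasDerivAt_update θ p t)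
  have h2 := (HasDerivAt.fun_sum (u := Finset.univ)
    fun j (_ : j ∈ Finset.univ) => (h1 (i, j)).mul_const (u j)).const_mul ρ
  refine h2.congr_deriv ?_
  obtain ⟨p1, p2⟩ := p
  by_cases hi : i = p1
  · subst hi
    simp [Pi.single_apply, Finset.sum_ite_eq']
  · simp [hi]

lemma hasDerivAt_regPdf [DecidableEq K] [DecidableEq L] (ρ : ℝ) (θ : L × K → ℝ)
    (q : (K → ℝ) × (L → ℝ)) (p : L × K) :
    HasDerivAt (fun t => regPdf ρ (Function.update θ p t) q)
      (regPdf ρ θ q * regScore ρ θ q p) (θ p) := by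
  have h := HasDerivAt.fun_finsetProd (u := Finset.univ) fun i (_ : i ∈ Finset.univ) =>
    (hasDerivAt_gaussianPDFReal (q.2 i - regMean ρ (Function.update θ p (θ p)) q.1 i)).comp (θ p)
      ((hasDerivAt_regMean ρ θ q.1 p i (θ p)).const_sub (q.2 i))
  refine h.congr_deriv ?_
  simp only [Function.comp_def, Function.update_eq_self, smul_eq_mul]
  -- The coordinate `p` influences only the mean of response `p.1`, so one factor of the product is
  -- differentiated.
  rw [Finset.sum_eq_single p.1]
  · simp only [if_true, regScore, outer, regPdf, PiLp.smul_apply, smul_eq_mul, Pi.sub_apply]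
    rw [← Finset.mul_prod_erase Finset.univ _ (Finset.mem_univ p.1)]; ring
  · intro i _ hi; simp [hi]
  · simp

lemma continuous_regScore [DecidableEq K] [DecidableEq L] (ρ : ℝ) (θ : L × K → ℝ)
    (q : (K → ℝ) × (L → ℝ)) (p : L × K) :
    Continuous fun t => regScore ρ (Function.update θ p t) q p := by
  have : Continuous fun t => regMean ρ (Function.update θ p t) q.1 p.1 :=
    continuous_iff_continuousAt.2 fun t => (hasDerivAt_regMean ρ θ q.1 p p.1 t).continuousAt
  simp only [regScore, outer, PiLp.smul_apply, smul_eq_mul, Pi.sub_apply]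
  fun_prop

/-- The linear regression model with Gaussian covariates and noise. -/
noncomputable def regModel (K L : Type*) [Fintype K] [Fintype L] [DecidableEq K] [DecidableEq L]
    {ρ : ℝ} (hρ : 0 ≤ ρ) : ScoreModel (L × K) ((K → ℝ) × (L → ℝ)) where
  base := (gaussPi K).prod volume
  sigmaFinite := inferInstance
  pdf := regPdf ρ
  measurable_pdf := measurable_regPdf ρ
  pdf_nonneg θ q := Finset.prod_nonneg fun _ _ => gaussianPDFReal_nonneg _ _ _
  score := regScore ρ
  measurable_score := measurable_regScore ρ
  hasDerivAt_pdf := hasDerivAt_regPdf ρ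
  continuous_score := continuous_regScore ρ
  isProbabilityMeasure θ := by
    rw [← map_regMap]
    exact Measure.isProbabilityMeasure_map (measurePreserving_regMap ρ θ).measurable.aemeasurable
  integrable_score θ := by
    rw [← map_regMap, integrable_map_measure
      (measurable_regScore_right ρ θ).aestronglyMeasurable
      (measurePreserving_regMap ρ θ).measurable.aemeasurable]
    refine (integrable_outer.smul ρ).congr (Filter.Eventually.of_forall fun q => ?_)
    exact (regScore_regMap ρ θ q).symm
  integral_score θ := by
    rw [← map_regMap, integral_map (measurePreserving_regMap ρ θ).measurable.aemeasurable
      (measurable_regScore_right ρ θ).aestronglyMeasurable]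
    simp only [regScore_regMap, integral_smul, integral_outer, smul_zero]
  σ := ρ
  integral_abs_inner_le θ a := by
    rw [← map_regMap, integral_map (measurePreserving_regMap ρ θ).measurable.aemeasurable
      (measurable_const.inner (measurable_regScore_right ρ θ)).abs.aestronglyMeasurable]
    simp only [regScore_regMap, inner_smul_right, abs_mul, integral_const_mul, abs_of_nonneg hρ]
    exact mul_le_mul_of_nonneg_left (integral_abs_inner_outer_le a) hρ
  κ := ρ * √(Fintype.card (L × K))
  integral_norm_score_le θ := by
    rw [← map_regMap, integral_map (measurePreserving_regMap ρ θ).measurable.aemeasurable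
      (measurable_regScore_right ρ θ).norm.aestronglyMeasurable]
    simp only [regScore_regMap, norm_smul, integral_const_mul, Real.norm_of_nonneg hρ]
    exact mul_le_mul_of_nonneg_left integral_norm_outer_le hρ

end Regression

/-! ### The one-dimensional scale model -/

section Scale

/-- The variance `(3/2) exp (θ / 4)` as a nonnegative real. -/
noncomputable def scaleVar (θ : Unit → ℝ) : NNReal :=
  ⟨3 / 2 * Real.exp (θ () / 4), by positivity⟩

lemma coe_scaleVar (θ : Unit → ℝ) : (scaleVar θ : ℝ) = 3 / 2 * Real.exp (θ () / 4) := rfl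

lemma scaleVar_pos (θ : Unit → ℝ) : (0 : ℝ) < scaleVar θ := by
  rw [coe_scaleVar]; positivity

lemma scaleVar_ne_zero (θ : Unit → ℝ) : scaleVar θ ≠ 0 := by
  have := scaleVar_pos θ
  exact_mod_cast this.ne'

lemma measurable_coe_scaleVar : Measurable fun θ : Unit → ℝ => (scaleVar θ : ℝ) := by
  simp only [coe_scaleVar]; fun_prop

/-- The score of the scale family. -/
noncomputable def scaleScore (θ : Unit → ℝ) (x : ℝ) : EuclideanSpace ℝ Unit :=
  WithLp.toLp 2 fun _ => (x ^ 2 / scaleVar θ - 1) / 8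

lemma measurable_scaleScore : Measurable (Function.uncurry scaleScore) := by
  refine (WithLp.measurable_toLp 2 (Unit → ℝ)).comp (measurable_pi_lambda _ fun _ => ?_)
  exact (((measurable_snd.pow_const 2).div
    (measurable_coe_scaleVar.comp measurable_fst)).sub_const 1).div_const 8

lemma withDensity_scale (θ : Unit → ℝ) :
    (volume : Measure ℝ).withDensity
      (fun x => ENNReal.ofReal (gaussianPDFReal 0 (scaleVar θ) x)) = gaussianReal 0 (scaleVar θ) :=
  (gaussianReal_of_var_ne_zero 0 (scaleVar_ne_zero θ)).symm

lemma integral_sq_gaussianReal (v : NNReal) : ∫ x, x ^ 2 ∂gaussianReal 0 v = v := by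
  have := variance_of_integral_eq_zero (μ := gaussianReal 0 v) (X := fun x => x)
    aemeasurable_id integral_id_gaussianReal
  rw [← this, variance_fun_id_gaussianReal]

lemma integrable_sq_gaussianReal (v : NNReal) : Integrable (fun x => x ^ 2) (gaussianReal 0 v) :=
  (memLp_id_gaussianReal 2).integrable_sq

lemma integrable_scaleScore_apply (θ : Unit → ℝ) (j : Unit) :
    Integrable (fun x => scaleScore θ x j) (gaussianReal 0 (scaleVar θ)) :=
  (((integrable_sq_gaussianReal _).div_const _).sub (integrable_const 1)).div_const 8

lemma norm_euclidean_unit (v : EuclideanSpace ℝ Unit) : ‖v‖ = |v ()| := by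
  rw [EuclideanSpace.norm_eq]; simp [Real.sqrt_sq_eq_abs]

/-- By the triangle inequality, `|x ^ 2 / v - 1| ≤ x ^ 2 / v + 1`, which has mean `2` under variance
`v`; dividing by `8` gives `1 / 4`. -/
lemma integral_abs_scaleScore_le (θ : Unit → ℝ) :
    ∫ x, |scaleScore θ x ()| ∂gaussianReal 0 (scaleVar θ) ≤ 1 / 4 := by
  have hi : Integrable (fun x : ℝ => (x ^ 2 / scaleVar θ + 1) / 8) (gaussianReal 0 (scaleVar θ)) :=
    (((integrable_sq_gaussianReal _).div_const _).add (integrable_const 1)).div_const 8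
  refine (integral_mono (integrable_scaleScore_apply θ ()).abs hi fun x => ?_).trans_eq ?_
  · have : 0 ≤ x ^ 2 / (scaleVar θ : ℝ) := by positivity
    simp only [scaleScore]
    rw [abs_le]; constructor <;> linarith
  · rw [integral_div, integral_add ((integrable_sq_gaussianReal _).div_const _)
      (integrable_const 1), integral_div, integral_sq_gaussianReal, div_self (scaleVar_pos θ).ne']
    simp; norm_num

lemma hasDerivAt_scalePdf (θ : Unit → ℝ) (x : ℝ) (j : Unit) :
    HasDerivAt (fun t => gaussianPDFReal 0 (scaleVar (Function.update θ j t)) x)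
      (gaussianPDFReal 0 (scaleVar θ) x * scaleScore θ x j) (θ j) := by
  -- Up to a constant, the log-density is `-θ / 8 - x ^ 2 / 3 * exp (-θ / 4)`, and its derivative in
  -- `θ` is the score.
  have hform : ∀ θ : Unit → ℝ, gaussianPDFReal 0 (scaleVar θ) x
      = (√(3 * Real.pi))⁻¹ *
        Real.exp (-(θ () / 8) - x ^ 2 / 3 * Real.exp (-(θ () / 4))) := by
    intro θ
    rw [gaussianPDFReal_def]
    simp only [sub_zero, coe_scaleVar]
    have h1 : √(2 * Real.pi * (3 / 2 * Real.exp (θ () / 4)))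
        = √(3 * Real.pi) * Real.exp (θ () / 8) := by
      rw [show 2 * Real.pi * (3 / 2 * Real.exp (θ () / 4))
        = (3 * Real.pi) * Real.exp (θ () / 8) ^ 2 by
          rw [← Real.exp_nat_mul]; push_cast; ring_nf]
      rw [Real.sqrt_mul (by positivity), Real.sqrt_sq (Real.exp_pos _).le]
    rw [h1, mul_inv, mul_assoc, ← Real.exp_neg, ← Real.exp_add]
    congr 2
    rw [Real.exp_neg]
    field_simp
    ring
  have hv : (x ^ 2 / scaleVar θ - 1) / 8
      = -(1 / 8) - x ^ 2 / 3 * (Real.exp (-(θ () / 4)) * -(1 / 4)) := by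
    rw [coe_scaleVar, Real.exp_neg]
    field_simp
    ring
  simp only [hform, Function.update_self]
  have hd : HasDerivAt (fun t : ℝ => -(t / 8) - x ^ 2 / 3 * Real.exp (-(t / 4)))
      (-(1 / 8) - x ^ 2 / 3 * (Real.exp (-(θ () / 4)) * -(1 / 4))) (θ ()) := by
    have h1 := ((hasDerivAt_id (θ ())).div_const 8).neg
    have h2 := (((hasDerivAt_id (θ ())).div_const 4).neg).exp.const_mul (x ^ 2 / 3)
    exact h1.sub h2
  refine (hd.exp.const_mul _).congr_deriv ?_
  simp only [scaleScore]
  rw [hv]; ring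

/-- The scale family of centred Gaussian laws on the line. -/
noncomputable def scaleModel : ScoreModel Unit ℝ where
  base := volume
  sigmaFinite := inferInstance
  pdf θ x := gaussianPDFReal 0 (scaleVar θ) x
  measurable_pdf := by
    simp only [gaussianPDFReal_def]
    have h1 : Measurable fun q : (Unit → ℝ) × ℝ => (scaleVar q.1 : ℝ) :=
      measurable_coe_scaleVar.comp measurable_fst
    unfold Function.uncurry
    fun_prop
  pdf_nonneg _ _ := gaussianPDFReal_nonneg _ _ _
  score := scaleScore
  measurable_score := measurable_scaleScore
  hasDerivAt_pdf := hasDerivAt_scalePdf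
  continuous_score θ x j := by
    have : ∀ t, Real.exp (t / 4) ≠ 0 := fun t => (Real.exp_pos _).ne'
    simp only [scaleScore, coe_scaleVar, Function.update_self]
    refine ((continuous_const.div (by fun_prop) fun t => ?_).sub continuous_const).div_const 8
    positivity
  isProbabilityMeasure θ := by rw [withDensity_scale]; infer_instance
  integrable_score θ := by
    rw [withDensity_scale]
    exact Integrable.of_eval_piLp fun j => integrable_scaleScore_apply θ j
  integral_score θ := by
    rw [withDensity_scale]
    have hi : Integrable (scaleScore θ) (gaussianReal 0 (scaleVar θ)) :=
      Integrable.of_eval_piLp fun j => integrable_scaleScore_apply θ j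
    ext j
    refine ((EuclideanSpace.proj (𝕜 := ℝ) j).integral_comp_comm hi).symm.trans ?_
    change ∫ x, (x ^ 2 / (scaleVar θ : ℝ) - 1) / 8 ∂gaussianReal 0 (scaleVar θ) = 0
    rw [integral_div, integral_sub ((integrable_sq_gaussianReal _).div_const _)
      (integrable_const 1), integral_div, integral_sq_gaussianReal, div_self (scaleVar_pos θ).ne']
    simp
  σ := 1 / 4
  integral_abs_inner_le θ a := by
    rw [withDensity_scale]
    have : ∀ x, |inner ℝ a (scaleScore θ x)| = ‖a‖ * |scaleScore θ x ()| := fun x => by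
      simp [PiLp.inner_apply, norm_euclidean_unit, abs_mul, mul_comm]
    simp only [this, integral_const_mul]
    rw [mul_comm]
    exact mul_le_mul_of_nonneg_right (integral_abs_scaleScore_le θ) (norm_nonneg a)
  κ := 1 / 4
  integral_norm_score_le θ := by
    rw [withDensity_scale]
    simp only [norm_euclidean_unit]
    exact integral_abs_scaleScore_le θ

end Scale

/-! ### Linear images of Gaussian vectors, uniform moments, and the scalar covariance family -/

lemma measurable_matrix_of {ι m' n' : Type*} [MeasurableSpace ι] {f : ι → Matrix m' n' ℝ}
    (h : ∀ i j, Measurable fun x => f x i j) : Measurable f :=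
  measurable_pi_lambda _ fun i => measurable_pi_lambda _ fun j => h i j

/-- Linear images of standard Gaussian vectors are Gaussian. -/
lemma map_mulVec_gaussPi {ι ι' : Type*} [Fintype ι] [DecidableEq ι] [Fintype ι']
    (G : Matrix ι ι' ℝ) :
    (gaussPi ι').map (fun z => (WithLp.toLp 2 (G.mulVec z) : EuclideanSpace ℝ ι))
      = multivariateGaussian 0 (G * G.transpose) := by
  have hm : Measurable fun z : ι' → ℝ => (WithLp.toLp 2 (G.mulVec z) : EuclideanSpace ℝ ι) := by
    refine (WithLp.measurable_toLp 2 (ι → ℝ)).comp (measurable_pi_lambda _ fun i => ?_)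
    simp only [Matrix.mulVec, dotProduct]; fun_prop
  have hprob : IsProbabilityMeasure
      ((gaussPi ι').map fun z => (WithLp.toLp 2 (G.mulVec z) : EuclideanSpace ℝ ι)) :=
    Measure.isProbabilityMeasure_map hm.aemeasurable
  have hpsd : (G * G.transpose).PosSemidef := by
    have := Matrix.posSemidef_self_mul_conjTranspose G
    rwa [Matrix.conjTranspose_eq_transpose_of_trivial] at this
  -- The characteristic function of the image at `t` is the standard one at `Gᵀ t`, and `‖Gᵀ t‖ ^ 2`
  -- is the quadratic form of `G * Gᵀ` at `t`.
  refine Measure.ext_of_charFun ?_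
  ext t
  rw [charFun_multivariateGaussian hpsd, charFun_apply, integral_map hm.aemeasurable
    (Measurable.aestronglyMeasurable (by fun_prop))]
  have hin : ∀ z : ι' → ℝ, inner ℝ (WithLp.toLp 2 (G.mulVec z) : EuclideanSpace ℝ ι) t
      = inner ℝ (WithLp.toLp 2 z : EuclideanSpace ℝ ι')
        (WithLp.toLp 2 (G.transpose.mulVec t.ofLp) : EuclideanSpace ℝ ι') := by
    intro z
    simp only [EuclideanSpace.inner_eq_star_dotProduct, star_trivial]
    rw [Matrix.mulVec_transpose, Matrix.dotProduct_mulVec]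
  simp only [hin]
  have hstd := charFun_stdGaussian
    (WithLp.toLp 2 (G.transpose.mulVec t.ofLp) : EuclideanSpace ℝ ι')
  rw [← map_pi_eq_stdGaussian, charFun_apply, integral_map
    (WithLp.measurable_toLp 2 (ι' → ℝ)).aemeasurable
    (Measurable.aestronglyMeasurable (by fun_prop))] at hstd
  refine hstd.trans ?_
  have hq : ‖(WithLp.toLp 2 (G.transpose.mulVec t.ofLp) : EuclideanSpace ℝ ι')‖ ^ 2
      = t.ofLp ⬝ᵥ (G * G.transpose).mulVec t.ofLp := by
    rw [← real_inner_self_eq_norm_sq, EuclideanSpace.inner_eq_star_dotProduct, star_trivial,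
      ← Matrix.mulVec_mulVec, Matrix.dotProduct_mulVec t.ofLp, Matrix.mulVec_transpose]
  rw [← Complex.ofReal_pow, hq]
  simp [neg_div]

lemma integrable_unifMeasure {f : ℝ → ℝ} (hf : Continuous f) : Integrable f unifMeasure :=
  (hf.integrableOn_Icc (a := -1) (b := 1)).smul_measure (by norm_num)

lemma integral_sq_unifMeasure : ∫ t, t ^ 2 ∂unifMeasure = 1 / 3 := by
  rw [integral_unifMeasure, integral_pow]; norm_num

lemma integral_cubeMeasure_apply {J : Type*} [Fintype J] (j : J) {f : ℝ → ℝ} (hf : Continuous f) :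
    ∫ θ, f (θ j) ∂cubeMeasure J = ∫ t, f t ∂unifMeasure :=
  integral_comp_eval (μ := fun _ : J => unifMeasure) (i := j) hf.aestronglyMeasurable

lemma integrable_cubeMeasure_apply {J : Type*} [Fintype J] (j : J) {f : ℝ → ℝ}
    (hf : Continuous f) : Integrable (fun θ => f (θ j)) (cubeMeasure J) :=
  integrable_comp_eval (μ := fun _ : J => unifMeasure) (i := j) (integrable_unifMeasure hf)

section Scalar

/-- The covariance matrix of the one-dimensional family. -/
noncomputable def scaleCov (θ : Unit → ℝ) : Matrix (Fin 1) (Fin 1) ℝ := (scaleVar θ : ℝ) • 1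

lemma measurable_scaleCov : Measurable scaleCov := by
  refine measurable_matrix_of fun i j => ?_
  simp only [scaleCov, Matrix.smul_apply, smul_eq_mul]
  exact measurable_coe_scaleVar.mul_const _

lemma scaleCov_apply (θ : Unit → ℝ) : scaleCov θ 0 0 = 3 / 2 * Real.exp (θ () / 4) := by
  simp [scaleCov, coe_scaleVar]

lemma injective_scaleCov : Function.Injective scaleCov := by
  intro θ θ' h
  have h0 := congrFun (congrFun h 0) 0
  rw [scaleCov_apply, scaleCov_apply] at h0
  have := Real.exp_injective (mul_left_cancel₀ (by norm_num) h0)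
  ext ⟨⟩
  linarith

lemma map_scaleModel_law (θ : Unit → ℝ) :
    (scaleModel.law θ).map (fun x => (WithLp.toLp 2 fun _ => x : EuclideanSpace ℝ (Fin 1)))
      = multivariateGaussian 0 (scaleCov θ) := by
  have hm : Measurable fun x : ℝ => (WithLp.toLp 2 fun _ => x : EuclideanSpace ℝ (Fin 1)) :=
    (WithLp.measurable_toLp 2 (Fin 1 → ℝ)).comp (measurable_pi_lambda _ fun _ => measurable_id)
  have h1 : scaleModel.law θ = (gaussPi (Fin 1)).map fun z => √(scaleVar θ) * z 0 := by
    have h2 := gaussianReal_map_const_mul (μ := 0) (v := 1) (√(scaleVar θ))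
    have h3 := (measurePreserving_eval (fun _ : Fin 1 => gaussianReal 0 1) 0).map_eq
    rw [← h3, Measure.map_map (by fun_prop) (by fun_prop), mul_zero] at h2
    refine (withDensity_scale θ).trans ?_
    refine Eq.trans ?_ h2.symm
    congr 1
    ext
    simp [Real.sq_sqrt (scaleVar_pos θ).le]
  have hG : scaleCov θ = (√(scaleVar θ) • (1 : Matrix (Fin 1) (Fin 1) ℝ))
      * (√(scaleVar θ) • (1 : Matrix (Fin 1) (Fin 1) ℝ)).transpose := by
    simp [scaleCov, smul_smul, Real.mul_self_sqrt (scaleVar_pos θ).le]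
  rw [hG, ← map_mulVec_gaussPi, h1, Measure.map_map hm (by fun_prop)]
  congr 1
  ext z i
  simp [Matrix.smul_mulVec, Subsingleton.elim i 0]

/-- The upper bound is `exp (t / 4) ≤ 1 / (1 - t / 4)`. Multiplied by `3 / 2`, these bounds place
the variance in `[9 / 8, 2]`, within `1 / 2` of `3 / 2`. -/
lemma exp_quarter_bounds {t : ℝ} (ht : t ∈ Set.Icc (-1 : ℝ) 1) :
    3 / 4 ≤ Real.exp (t / 4) ∧ Real.exp (t / 4) ≤ 4 / 3 := by
  have h1 := Real.add_one_le_exp (t / 4)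
  have h2 := Real.add_one_le_exp (-(t / 4))
  have h3 : Real.exp (t / 4) * Real.exp (-(t / 4)) = 1 := by rw [← Real.exp_add]; simp
  refine ⟨by linarith [ht.1], ?_⟩
  nlinarith [ht.2, Real.exp_pos (t / 4)]

lemma scaleCov_bounds {θ : Unit → ℝ} (hθ : ∀ j, θ j ∈ Set.Icc (-1 : ℝ) 1) :
    1 ≤ scaleCov θ ∧ scaleCov θ ≤ (2 : ℝ) • 1 := by
  obtain ⟨h1, h2⟩ := exp_quarter_bounds (hθ ())
  constructor
  · rw [Matrix.le_iff]
    have : scaleCov θ - 1 = ((scaleVar θ : ℝ) - 1) • 1 := by rw [sub_smul, one_smul]; rfl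
    rw [this]
    exact Matrix.PosSemidef.one.smul (by rw [coe_scaleVar]; linarith)
  · rw [Matrix.le_iff]
    have : (2 : ℝ) • 1 - scaleCov θ = (2 - (scaleVar θ : ℝ)) • 1 := by rw [sub_smul]; rfl
    rw [this]
    exact Matrix.PosSemidef.one.smul (by rw [coe_scaleVar]; linarith)

/-- The integrand dominates `3 * t + 9 / 16 * t ^ 2` on `[-1, 1]`, and the linear term has mean
zero. For negative `t` this uses `exp s ≤ 1 + s * exp s ≤ 1 + 3 / 4 * s` with `s = t / 4`. -/
lemma le_integral_scale :
    3 / 16 ≤ ∫ θ : Unit → ℝ, 2 * θ () * (3 / 2 * Real.exp (θ () / 4)) ∂cubeMeasure Unit := by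
  rw [integral_cubeMeasure_apply () (f := fun t => 2 * t * (3 / 2 * Real.exp (t / 4)))
    (by fun_prop)]
  have h1 : ∫ t, (3 * t + 9 / 16 * t ^ 2) ∂unifMeasure = 3 / 16 := by
    rw [integral_add (integrable_unifMeasure (by fun_prop)) (integrable_unifMeasure (by fun_prop)),
      integral_const_mul, integral_const_mul, integral_sq_unifMeasure, integral_unifMeasure,
      integral_id]
    norm_num
  rw [← h1]
  refine integral_mono_ae (integrable_unifMeasure (by fun_prop))
    (integrable_unifMeasure (by fun_prop)) (ae_unifMeasure_mem.mono fun t ht => ?_)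
  have e1 := Real.add_one_le_exp (t / 4)
  have e2 := Real.add_one_le_exp (-(t / 4))
  have e3 : Real.exp (t / 4) * Real.exp (-(t / 4)) = 1 := by rw [← Real.exp_add]; simp
  obtain ⟨h2, h3⟩ := exp_quarter_bounds ht
  simp only
  rcases le_total 0 t with h0 | h0
  · nlinarith [mul_le_mul_of_nonneg_left e1 h0]
  · have h5 : Real.exp (t / 4) * (-(t / 4) + 1) ≤ 1 := by
      exact (mul_le_mul_of_nonneg_left e2 (Real.exp_pos _).le).trans_eq e3
    have h6 : Real.exp (t / 4) ≤ 1 + 3 / 16 * t := by nlinarith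
    nlinarith [mul_le_mul_of_nonpos_left h6 h0]

end Scalar

/-! ### The block covariance of the regression model -/

section Block

variable {k l : ℕ}

/-- The coefficient matrix of the regression. -/
noncomputable def coefMatrix (ρ : ℝ) (θ : Fin l × Fin k → ℝ) : Matrix (Fin l) (Fin k) ℝ :=
  Matrix.of fun i j => ρ * θ (i, j)

/-- The linear map from standard Gaussian noise to the samples. -/
noncomputable def blockRoot (ρ : ℝ) (θ : Fin l × Fin k → ℝ) :
    Matrix (Fin k ⊕ Fin l) (Fin k ⊕ Fin l) ℝ :=
  √(4 / 3) • Matrix.fromBlocks 1 0 (coefMatrix ρ θ) 1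

/-- The covariance matrix of the samples, with rows and columns split in two blocks. -/
noncomputable def blockCov (ρ : ℝ) (θ : Fin l × Fin k → ℝ) :
    Matrix (Fin k ⊕ Fin l) (Fin k ⊕ Fin l) ℝ :=
  (4 / 3 : ℝ) • Matrix.fromBlocks 1 (coefMatrix ρ θ).transpose (coefMatrix ρ θ)
    (coefMatrix ρ θ * (coefMatrix ρ θ).transpose + 1)

/-- The covariance matrix of the samples. -/
noncomputable def regCov (ρ : ℝ) (θ : Fin l × Fin k → ℝ) : Matrix (Fin (k + l)) (Fin (k + l)) ℝ :=
  (blockCov ρ θ).submatrix finSumFinEquiv.symm finSumFinEquiv.symm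

lemma blockRoot_mul_transpose (ρ : ℝ) (θ : Fin l × Fin k → ℝ) :
    blockRoot ρ θ * (blockRoot ρ θ).transpose = blockCov ρ θ := by
  rw [blockRoot, blockCov, Matrix.transpose_smul, Matrix.smul_mul, Matrix.mul_smul, smul_smul,
    Real.mul_self_sqrt (by norm_num), Matrix.fromBlocks_transpose, Matrix.fromBlocks_multiply]
  simp

lemma regCov_apply (ρ : ℝ) (θ : Fin l × Fin k → ℝ) (i : Fin l) (j : Fin k) :
    regCov ρ θ (Fin.natAdd k i) (Fin.castAdd l j) = 4 / 3 * ρ * θ (i, j) := by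
  simp [regCov, blockCov, coefMatrix, mul_assoc]

lemma injective_regCov {ρ : ℝ} (hρ : 0 < ρ) :
    Function.Injective (regCov ρ : (Fin l × Fin k → ℝ) → _) := by
  intro θ θ' h
  ext ⟨i, j⟩
  have := congrFun (congrFun h (Fin.natAdd k i)) (Fin.castAdd l j)
  rw [regCov_apply, regCov_apply] at this
  exact mul_left_cancel₀ (by positivity) this

lemma measurable_regCov (ρ : ℝ) : Measurable (regCov ρ : (Fin l × Fin k → ℝ) → _) := by
  refine measurable_matrix_of fun i j => ?_
  simp only [regCov, Matrix.submatrix_apply, blockCov, Matrix.smul_apply, smul_eq_mul]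
  refine Measurable.const_mul ?_ _
  rcases finSumFinEquiv.symm i with i | i <;> rcases finSumFinEquiv.symm j with j | j
  · simp only [Matrix.fromBlocks_apply₁₁]; fun_prop
  · simp only [Matrix.fromBlocks_apply₁₂, Matrix.transpose_apply, coefMatrix, Matrix.of_apply]
    fun_prop
  · simp only [Matrix.fromBlocks_apply₂₁, coefMatrix, Matrix.of_apply]
    fun_prop
  · simp only [Matrix.fromBlocks_apply₂₂, Matrix.add_apply, Matrix.mul_apply,
      Matrix.transpose_apply, coefMatrix, Matrix.of_apply]
    fun_prop

/-- A sample in `ℝ^(k + l)` made from covariates and responses. -/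
noncomputable def regSample (q : (Fin k → ℝ) × (Fin l → ℝ)) : EuclideanSpace ℝ (Fin (k + l)) :=
  WithLp.toLp 2 fun i => √(4 / 3) * Sum.elim q.1 q.2 (finSumFinEquiv.symm i)

lemma measurable_regSample :
    Measurable (regSample : (Fin k → ℝ) × (Fin l → ℝ) → EuclideanSpace ℝ (Fin (k + l))) := by
  refine (WithLp.measurable_toLp 2 (Fin (k + l) → ℝ)).comp (measurable_pi_lambda _ fun i => ?_)
  refine Measurable.const_mul ?_ _
  rcases finSumFinEquiv.symm i with i | i <;> simp only [Sum.elim_inl, Sum.elim_inr] <;> fun_prop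

lemma map_regModel_law {ρ : ℝ} (hρ : 0 ≤ ρ) (θ : Fin l × Fin k → ℝ) :
    ((regModel (Fin k) (Fin l) hρ).law θ).map regSample = multivariateGaussian 0 (regCov ρ θ) := by
  -- With this factorization both laws are images of one standard Gaussian vector, and it remains to
  -- compare the two maps.
  have hG : regCov ρ θ = (blockRoot ρ θ).submatrix finSumFinEquiv.symm id
      * ((blockRoot ρ θ).submatrix finSumFinEquiv.symm id).transpose := by
    rw [regCov, ← blockRoot_mul_transpose, Matrix.transpose_submatrix]
    exact Matrix.submatrix_mul _ _ _ id _ Function.bijective_id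
  have hprod : (gaussPi (Fin k ⊕ Fin l)).map
      (MeasurableEquiv.sumPiEquivProdPi fun _ : Fin k ⊕ Fin l => ℝ)
      = (gaussPi (Fin k)).prod (gaussPi (Fin l)) :=
    (measurePreserving_sumPiEquivProdPi (fun _ : Fin k ⊕ Fin l => gaussianReal 0 1)).map_eq
  have hlaw : (regModel (Fin k) (Fin l) hρ).law θ
      = ((gaussPi (Fin k)).prod (gaussPi (Fin l))).map (regMap ρ θ) := (map_regMap ρ θ).symm
  have hrm := (measurePreserving_regMap (K := Fin k) ρ θ).measurable
  rw [hG, ← map_mulVec_gaussPi, hlaw, ← hprod, Measure.map_map hrm (by fun_prop),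
    Measure.map_map measurable_regSample (hrm.comp (by fun_prop))]
  congr 1
  ext z i
  simp only [Function.comp, regSample, Matrix.mulVec, dotProduct, Matrix.submatrix_apply, id,
    blockRoot, Matrix.smul_apply, smul_eq_mul, mul_assoc, ← Finset.mul_sum, Fintype.sum_sum_type]
  congr 1
  have hinl : ∀ j, ((MeasurableEquiv.sumPiEquivProdPi fun _ : Fin k ⊕ Fin l => ℝ) z).1 j
      = z (.inl j) := fun _ => rfl
  have hinr : ∀ j, ((MeasurableEquiv.sumPiEquivProdPi fun _ : Fin k ⊕ Fin l => ℝ) z).2 j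
      = z (.inr j) := fun _ => rfl
  rcases finSumFinEquiv.symm i with i | i
  · simp [regMap, Matrix.one_apply, hinl]
  · simp [regMap, regMean, hinl, hinr, Matrix.one_apply, coefMatrix, Finset.mul_sum, mul_assoc, add_comm]

/-- The bilinear form of the block covariance matrix. -/
lemma dotProduct_blockCov_mulVec (ρ : ℝ) (θ : Fin l × Fin k → ℝ) (x : Fin k ⊕ Fin l → ℝ) :
    x ⬝ᵥ (blockCov ρ θ).mulVec x
      = 4 / 3 * (∑ j, (x (.inl j) + ∑ i, ρ * θ (i, j) * x (.inr i)) ^ 2 + ∑ i, x (.inr i) ^ 2) := by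
  rw [← blockRoot_mul_transpose, ← Matrix.mulVec_mulVec, Matrix.dotProduct_mulVec,
    ← Matrix.mulVec_transpose, blockRoot, Matrix.transpose_smul, Matrix.smul_mulVec,
    smul_dotProduct, dotProduct_smul, smul_smul, Real.mul_self_sqrt (by norm_num), smul_eq_mul,
    Matrix.fromBlocks_transpose]
  congr 1
  simp only [dotProduct, Fintype.sum_sum_type, ← sq]
  congr 1
  · refine Finset.sum_congr rfl fun j _ => ?_
    simp [Matrix.mulVec, dotProduct, Fintype.sum_sum_type, coefMatrix, Matrix.one_apply]
  · refine Finset.sum_congr rfl fun j _ => ?_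
    simp [Matrix.mulVec, dotProduct, Fintype.sum_sum_type, Matrix.one_apply]

lemma isHermitian_blockCov (ρ : ℝ) (θ : Fin l × Fin k → ℝ) : (blockCov ρ θ).IsHermitian := by
  rw [← blockRoot_mul_transpose, ← Matrix.conjTranspose_eq_transpose_of_trivial]
  exact Matrix.isHermitian_mul_conjTranspose_self _

/-- Cauchy–Schwarz: the operator norm of the coefficient matrix is at most its Frobenius norm, which
is at most `ρ * √(k * l)` in absolute value on the cube. -/
lemma sum_sq_coef_le {ρ : ℝ} (hρ : ρ ^ 2 * (k * l) ≤ 1 / 16) {θ : Fin l × Fin k → ℝ}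
    (hθ : ∀ p, θ p ∈ Set.Icc (-1 : ℝ) 1) (c : Fin l → ℝ) :
    ∑ j, (∑ i, ρ * θ (i, j) * c i) ^ 2 ≤ 1 / 16 * ∑ i, c i ^ 2 := by
  calc ∑ j, (∑ i, ρ * θ (i, j) * c i) ^ 2
      ≤ ∑ _j : Fin k, (ρ ^ 2 * l) * ∑ i, c i ^ 2 := by
        refine Finset.sum_le_sum fun j _ => ?_
        refine (Finset.sum_mul_sq_le_sq_mul_sq _ _ _).trans ?_
        refine mul_le_mul_of_nonneg_right ?_ (Finset.sum_nonneg fun i _ => sq_nonneg _)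
        calc ∑ i, (ρ * θ (i, j)) ^ 2 ≤ ∑ _i : Fin l, ρ ^ 2 := by
              refine Finset.sum_le_sum fun i _ => ?_
              rw [mul_pow]
              refine mul_le_of_le_one_right (sq_nonneg ρ) ?_
              nlinarith [(hθ (i, j)).1, (hθ (i, j)).2]
          _ = ρ ^ 2 * l := by simp [mul_comm]
    _ = ρ ^ 2 * (k * l) * ∑ i, c i ^ 2 := by simp; ring
    _ ≤ _ := mul_le_mul_of_nonneg_right hρ (Finset.sum_nonneg fun i _ => sq_nonneg _)

/-- The quadratic form is `4 / 3 * (|x + Bᵀ y| ^ 2 + |y| ^ 2)` with `|Bᵀ y| ^ 2 ≤ |y| ^ 2 / 16`.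
Young's inequality removes the cross term; the factor `4 / 3` leaves room on both sides, between `1`
and `2`. -/
lemma regCov_bounds {ρ : ℝ} (hρ : ρ ^ 2 * (k * l) ≤ 1 / 16) {θ : Fin l × Fin k → ℝ}
    (hθ : ∀ p, θ p ∈ Set.Icc (-1 : ℝ) 1) : 1 ≤ regCov ρ θ ∧ regCov ρ θ ≤ (2 : ℝ) • 1 := by
  have hone : (1 : Matrix (Fin (k + l)) (Fin (k + l)) ℝ)
      = (1 : Matrix (Fin k ⊕ Fin l) (Fin k ⊕ Fin l) ℝ).submatrix finSumFinEquiv.symm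
        finSumFinEquiv.symm := by simp
  have hx : ∀ x : Fin k ⊕ Fin l → ℝ, x ⬝ᵥ x = ∑ j, x (.inl j) ^ 2 + ∑ i, x (.inr i) ^ 2 := by
    intro x
    simp [dotProduct, Fintype.sum_sum_type, sq]
  constructor
  · rw [Matrix.le_iff]
    have : (blockCov ρ θ - 1).PosSemidef := by
      refine Matrix.PosSemidef.of_dotProduct_mulVec_nonneg
        ((isHermitian_blockCov ρ θ).sub Matrix.isHermitian_one) fun x => ?_
      rw [star_trivial, Matrix.sub_mulVec, dotProduct_sub, Matrix.one_mulVec, hx,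
        dotProduct_blockCov_mulVec]
      have h1 := sum_sq_coef_le hρ hθ fun i => x (.inr i)
      have h2 : ∑ j, x (.inl j) ^ 2
          ≤ 4 / 3 * ∑ j, (x (.inl j) + ∑ i, ρ * θ (i, j) * x (.inr i)) ^ 2
            + 4 * ∑ j, (∑ i, ρ * θ (i, j) * x (.inr i)) ^ 2 := by
        rw [Finset.mul_sum, Finset.mul_sum, ← Finset.sum_add_distrib]
        refine Finset.sum_le_sum fun j _ => ?_
        -- Young's inequality `a ^ 2 ≤ 4 / 3 * (a + b) ^ 2 + 4 * b ^ 2`; the difference of the two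
        -- sides is `(a + 4 * b) ^ 2 / 3`.
        nlinarith [sq_nonneg (x (.inl j) + 4 * ∑ i, ρ * θ (i, j) * x (.inr i))]
      have h3 : 0 ≤ ∑ i, x (.inr i) ^ 2 := Finset.sum_nonneg fun i _ => sq_nonneg _
      linarith
    have := this.submatrix finSumFinEquiv.symm
    rw [Matrix.submatrix_sub, Pi.sub_apply, Pi.sub_apply] at this
    rwa [hone]
  · rw [Matrix.le_iff]
    have : ((2 : ℝ) • 1 - blockCov ρ θ).PosSemidef := by
      refine Matrix.PosSemidef.of_dotProduct_mulVec_nonneg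
        ((Matrix.isHermitian_one.smul (IsSelfAdjoint.all (2 : ℝ))).sub
          (isHermitian_blockCov ρ θ)) fun x => ?_
      rw [star_trivial, Matrix.sub_mulVec, dotProduct_sub, Matrix.smul_mulVec, Matrix.one_mulVec,
        dotProduct_smul, smul_eq_mul, hx, dotProduct_blockCov_mulVec]
      have h1 := sum_sq_coef_le hρ hθ fun i => x (.inr i)
      have h2 : ∑ j, (x (.inl j) + ∑ i, ρ * θ (i, j) * x (.inr i)) ^ 2
          ≤ 3 / 2 * ∑ j, x (.inl j) ^ 2 + 3 * ∑ j, (∑ i, ρ * θ (i, j) * x (.inr i)) ^ 2 := by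
        rw [Finset.mul_sum, Finset.mul_sum, ← Finset.sum_add_distrib]
        refine Finset.sum_le_sum fun j _ => ?_
        nlinarith [sq_nonneg (x (.inl j) - 2 * ∑ i, ρ * θ (i, j) * x (.inr i))]
      have h3 : 0 ≤ ∑ i, x (.inr i) ^ 2 := Finset.sum_nonneg fun i _ => sq_nonneg _
      linarith
    have := this.submatrix finSumFinEquiv.symm
    rw [Matrix.submatrix_sub, Pi.sub_apply, Pi.sub_apply, Matrix.submatrix_smul, Pi.smul_apply,
      Pi.smul_apply] at this
    rwa [hone]

/-- The off-diagonal block of a matrix, as a vector. -/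
noncomputable def offBlock (A : Matrix (Fin (k + l)) (Fin (k + l)) ℝ) :
    EuclideanSpace ℝ (Fin l × Fin k) :=
  WithLp.toLp 2 fun p => A (Fin.natAdd k p.1) (Fin.castAdd l p.2)

lemma measurable_offBlock :
    Measurable (offBlock : Matrix (Fin (k + l)) (Fin (k + l)) ℝ → _) :=
  (WithLp.measurable_toLp 2 (Fin l × Fin k → ℝ)).comp
    (measurable_pi_lambda _ fun _ => measurable_matrix_apply _ _)

lemma norm_offBlock_sub_le (A B : Matrix (Fin (k + l)) (Fin (k + l)) ℝ) :
    ‖offBlock A - offBlock B‖ ≤ frobNorm (A - B) := by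
  refine (pow_le_pow_iff_left₀ (norm_nonneg _) (frobNorm_nonneg _) two_ne_zero).1 ?_
  rw [frobNorm_sq_eq_sum, EuclideanSpace.norm_sq_eq, Fintype.sum_prod_type]
  simp only [Fin.sum_univ_add, offBlock, PiLp.sub_apply, Matrix.sub_apply, Real.norm_eq_abs, sq_abs,
    Finset.sum_add_distrib]
  have h : ∀ (a b : ℕ) (f : Fin a → Fin b → ℝ), 0 ≤ ∑ i, ∑ j, f i j ^ 2 := fun a b f =>
    Finset.sum_nonneg fun i _ => Finset.sum_nonneg fun j _ => sq_nonneg _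
  have h1 := h k k fun i j => A (Fin.castAdd l i) (Fin.castAdd l j)
    - B (Fin.castAdd l i) (Fin.castAdd l j)
  have h2 := h k l fun i j => A (Fin.castAdd l i) (Fin.natAdd k j)
    - B (Fin.castAdd l i) (Fin.natAdd k j)
  have h3 := h l l fun i j => A (Fin.natAdd k i) (Fin.natAdd k j)
    - B (Fin.natAdd k i) (Fin.natAdd k j)
  linarith

end Block

/-! ### The sample complexity bounds and the choice of constants -/

/-- The sample complexity bound in Frobenius norm, in one dimension. -/
lemma frobenius_bound_one :
    ∃ D : Measure (Matrix (Fin 1) (Fin 1) ℝ), IsProbabilityMeasure D ∧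
      (∀ᵐ Sig ∂D, 1 ≤ Sig ∧ Sig ≤ (2 : ℝ) • 1) ∧
      ∀ (n : ℕ) (β ε δ : ℝ), 0 ≤ β → β ≤ 1 / 18 → 0 ≤ ε → ε ≤ 1 → 0 ≤ δ → n * δ ≤ 1 / 20 →
        ∀ M : Kernel (Fin n → EuclideanSpace ℝ (Fin 1)) (Matrix (Fin 1) (Fin 1) ℝ),
          IsMarkovKernel M → IsDP ε δ M →
          expectedSqError (fun _ A => frobNorm A) D M ≤ ENNReal.ofReal (β ^ 2) →
          1 / 72 ≤ n * (β * ε) := by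
  refine ⟨(cubeMeasure Unit).map scaleCov,
    Measure.isProbabilityMeasure_map measurable_scaleCov.aemeasurable, ?_, ?_⟩
  · rw [(measurableEmbedding_matrix measurable_scaleCov injective_scaleCov).ae_map_iff]
    exact (ae_cubeMeasure_mem Unit).mono fun θ hθ => scaleCov_bounds hθ
  · intro n β ε δ hβ hβ1 hε hε1 hδ hnδ M hM hDP herr
    have hm : Measurable fun x : ℝ => (WithLp.toLp 2 fun _ => x : EuclideanSpace ℝ (Fin 1)) :=
      (WithLp.measurable_toLp 2 (Fin 1 → ℝ)).comp (measurable_pi_lambda _ fun _ => measurable_id)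
    have hex : Measurable fun A : Matrix (Fin 1) (Fin 1) ℝ =>
        (WithLp.toLp 2 fun _ => A 0 0 : EuclideanSpace ℝ Unit) :=
      (WithLp.measurable_toLp 2 (Unit → ℝ)).comp
        (measurable_pi_lambda _ fun _ => measurable_matrix_apply 0 0)
    have hb := scaleModel.covariance_bound hm measurable_scaleCov injective_scaleCov
      map_scaleModel_law hex (c := WithLp.toLp 2 fun _ => 3 / 2) (r := 1 / 2) (fun A B => by
        refine (pow_le_pow_iff_left₀ (norm_nonneg _) (frobNorm_nonneg _) two_ne_zero).1 ?_
        rw [frobNorm_sq_eq_sum, norm_euclidean_unit, sq_abs]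
        simp) (fun θ hθ => by
        obtain ⟨h1, h2⟩ := exp_quarter_bounds (hθ ())
        rw [norm_euclidean_unit]
        simp only [PiLp.sub_apply, scaleCov_apply]
        rw [abs_le]; constructor <;> linarith) M hε hε1 hδ hDP
        (show (0 : ℝ) ≤ 1 / 4 by norm_num) hβ herr
    have hl := le_integral_scale
    simp only [Finset.univ_unique, Finset.sum_singleton, scaleCov_apply, Fintype.card_unit,
      Nat.cast_one, Real.sqrt_one, PUnit.default_eq_unit] at hb
    have hσ : scaleModel.σ = 1 / 4 := rfl
    have hκ : scaleModel.κ = 1 / 4 := rfl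
    rw [hσ, hκ] at hb
    -- Accuracy leaves at least `3 / 16 - 2 / 18 = 11 / 144`, and the `δ` term takes at most `3 /
    -- 80` of it.
    have : (n : ℝ) * (2 * ε * (1 / 4) * β + 2 * δ * (3 * (1 / 2)) * (1 / 4))
        = 1 / 2 * (n * (β * ε)) + 3 / 4 * (n * δ) := by ring
    rw [this] at hb
    linarith

/-- The sample complexity bound in Frobenius norm, in dimension at least two. -/
lemma frobenius_bound_add (k l : ℕ) (hk : 0 < k) (hl : 0 < l) :
    ∃ D : Measure (Matrix (Fin (k + l)) (Fin (k + l)) ℝ), IsProbabilityMeasure D ∧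
      (∀ᵐ Sig ∂D, 1 ≤ Sig ∧ Sig ≤ (2 : ℝ) • 1) ∧
      ∀ (n : ℕ) (β ε δ : ℝ), 0 ≤ β → β ≤ 1 / 18 → 0 ≤ ε → ε ≤ 1 → 0 ≤ δ → n * δ ≤ 1 / 20 →
        ∀ M : Kernel (Fin n → EuclideanSpace ℝ (Fin (k + l)))
            (Matrix (Fin (k + l)) (Fin (k + l)) ℝ),
          IsMarkovKernel M → IsDP ε δ M →
          expectedSqError (fun _ A => frobNorm A) D M ≤ ENNReal.ofReal (β ^ 2) →
          (k * l : ℝ) / 9 ≤ n * (β * ε) := by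
  set N : ℝ := √(k * l) with hN
  have hkl : (1 : ℝ) ≤ k * l := by exact_mod_cast Nat.mul_pos hk hl
  have hN2 : N ^ 2 = k * l := Real.sq_sqrt (by linarith)
  have hN1 : 1 ≤ N := Real.one_le_sqrt.2 hkl
  -- This makes `ρ ^ 2 * (k * l)` equal to `1 / 16`, the limit allowed by `regCov_bounds`.
  set ρ : ℝ := 1 / (4 * N) with hρdef
  have hρ : 0 < ρ := by positivity
  have hρN : ρ * N = 1 / 4 := by rw [hρdef]; field_simp
  have hρ2 : ρ ^ 2 * (k * l) ≤ 1 / 16 := by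
    rw [← hN2, ← mul_pow, hρN]; norm_num
  refine ⟨(cubeMeasure (Fin l × Fin k)).map (regCov ρ),
    Measure.isProbabilityMeasure_map (measurable_regCov ρ).aemeasurable, ?_, ?_⟩
  · rw [(measurableEmbedding_matrix (measurable_regCov ρ) (injective_regCov hρ)).ae_map_iff]
    exact (ae_cubeMeasure_mem _).mono fun θ hθ => regCov_bounds hρ2 hθ
  · intro n β ε δ hβ hβ1 hε hε1 hδ hnδ M hM hDP herr
    have hcard : √(Fintype.card (Fin l × Fin k) : ℝ) = N := by
      rw [hN]; simp [mul_comm]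
    have hoff : ∀ (θ : Fin l × Fin k → ℝ) (p : Fin l × Fin k), offBlock (regCov ρ θ) p
        = 4 / 3 * ρ * θ p := fun θ p =>
      regCov_apply ρ θ p.1 p.2
    have hb := (regModel (Fin k) (Fin l) hρ.le).covariance_bound measurable_regSample
      (measurable_regCov ρ) (injective_regCov hρ) (map_regModel_law hρ.le) measurable_offBlock
      -- The block has norm at most `4 / 3 * ρ * N = 1 / 3` in every dimension. The truncated error
      -- is then at most `1`, and with `κ = ρ * N = 1 / 4` the `δ` term is `n * δ / 2`.
      norm_offBlock_sub_le (c := 0) (r := 1 / 3) (fun θ hθ => by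
        refine (pow_le_pow_iff_left₀ (norm_nonneg _) (by norm_num) two_ne_zero).1 ?_
        rw [sub_zero, EuclideanSpace.norm_sq_eq]
        calc ∑ p, ‖offBlock (regCov ρ θ) p‖ ^ 2 ≤ ∑ _p : Fin l × Fin k, (4 / 3 * ρ) ^ 2 := by
              refine Finset.sum_le_sum fun p _ => ?_
              rw [hoff, Real.norm_eq_abs, sq_abs, mul_pow _ (θ p)]
              refine mul_le_of_le_one_right (sq_nonneg _) ?_
              nlinarith [(hθ p).1, (hθ p).2]
          _ = 16 / 9 * (ρ ^ 2 * (k * l)) := by simp; ring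
          _ ≤ (1 / 3) ^ 2 := by linarith) M hε hε1 hδ hDP hρ.le hβ herr
    -- Each of the `N ^ 2` coordinates contributes `8 / 3 * ρ` times the second moment `1 / 3`.
    have hint : ∫ θ, ∑ p, 2 * θ p * offBlock (regCov ρ θ) p ∂cubeMeasure (Fin l × Fin k)
        = 2 / 9 * N := by
      have h1 : ∀ p : Fin l × Fin k, ∫ θ, 2 * θ p * offBlock (regCov ρ θ) p
          ∂cubeMeasure (Fin l × Fin k) = 8 / 9 * ρ := fun p => by
        simp only [hoff]
        have e : ∀ θ : Fin l × Fin k → ℝ,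
            2 * θ p * (4 / 3 * ρ * θ p) = 8 / 3 * ρ * θ p ^ 2 := fun θ => by ring
        simp only [e, integral_const_mul]
        rw [integral_cubeMeasure_apply p (f := fun t => t ^ 2) (by fun_prop),
          integral_sq_unifMeasure]
        ring
      rw [integral_finsetSum]
      · simp only [h1, Finset.sum_const, Finset.card_univ, Fintype.card_prod, Fintype.card_fin,
          nsmul_eq_mul]
        push_cast
        have : (l : ℝ) * k * (8 / 9 * ρ) = 8 / 9 * ((k * l) * ρ) := by ring
        rw [this, ← hN2, show N ^ 2 * ρ = N * (ρ * N) by ring, hρN]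
        ring
      · intro p _
        simp only [hoff]
        exact integrable_cubeMeasure_apply p (f := fun t => 2 * t * (4 / 3 * ρ * t)) (by fun_prop)
    have hσ : (regModel (Fin k) (Fin l) hρ.le).σ = ρ := rfl
    have hκ : (regModel (Fin k) (Fin l) hρ.le).κ = 1 / 4 := by
      rw [← hρN, ← hcard]; rfl
    rw [hint, hσ, hκ, hcard] at hb
    have h2 : (n : ℝ) * (2 * ε * ρ * β + 2 * δ * (3 * (1 / 3)) * (1 / 4))
        = 2 * ρ * (n * (β * ε)) + 1 / 2 * (n * δ) := by ring
    rw [h2] at hb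
    -- From `2 / 9 * N` the estimation error removes at most `N / 9` since `β ≤ 1 / 18`, and the `δ`
    -- term at most `1 / 40 ≤ N / 18` since `N ≥ 1`.
    have h3 : N / 18 ≤ 2 * ρ * (n * (β * ε)) := by nlinarith
    have h4 := mul_le_mul_of_nonneg_left h3 (by positivity : 0 ≤ 2 * N)
    have h5 : 2 * N * (2 * ρ * (n * (β * ε))) = 4 * (ρ * N) * (n * (β * ε)) := by ring
    rw [h5, hρN] at h4
    rw [← hN2]
    linarith

/-- The constants `c₁`, `c₂`, `c₃` are absolute, and the prior `D` depends only on `d`. The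
second term of the minimum only matters when `log (n / d²) > 1`; the `max` discards it when the
logarithm is small or negative. -/
theorem theorem4p1 :
    ∃ c₁ c₂ c₃ : ℝ, 0 < c₁ ∧ 0 < c₂ ∧ 0 < c₃ ∧
      ∀ d : ℕ, 1 ≤ d →
        ∃ D : Measure (Matrix (Fin d) (Fin d) ℝ), IsProbabilityMeasure D ∧
          (∀ᵐ Sig ∂D, 1 ≤ Sig ∧ Sig ≤ (2 : ℝ) • 1) ∧
          ∀ (n : ℕ) (α ε δ : ℝ), 0 ≤ α → α ≤ c₁ → 0 ≤ ε → ε ≤ 1 → 0 ≤ δ → δ ≤ 1 →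
            δ ≤ c₂ * min (1 / (n : ℝ))
              ((d : ℝ) ^ 2 / ((n : ℝ) * max 1 (Real.log ((n : ℝ) / (d : ℝ) ^ 2)))) →
            ∀ M : Kernel (Fin n → EuclideanSpace ℝ (Fin d)) (Matrix (Fin d) (Fin d) ℝ),
              IsMarkovKernel M → IsDP ε δ M →
              (expectedSqError mahaNorm D M ≤ ENNReal.ofReal (α ^ 2) ∨
                expectedSqError (fun _ A => frobNorm A) D M ≤ ENNReal.ofReal (α ^ 2)) →
              c₃ * (d : ℝ) ^ 2 ≤ (n : ℝ) * (α * ε) := by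

  -- The first and third constants are half of `1 / 18` and `1 / 72`, because Mahalanobis accuracy
  -- `α` becomes Frobenius accuracy `2 * α`.
  refine ⟨1 / 36, 1 / 20, 1 / 144, by norm_num, by norm_num, by norm_num, fun d hd => ?_⟩
  have hcore : ∃ D : Measure (Matrix (Fin d) (Fin d) ℝ), IsProbabilityMeasure D ∧
      (∀ᵐ Sig ∂D, 1 ≤ Sig ∧ Sig ≤ (2 : ℝ) • 1) ∧
      ∀ (n : ℕ) (β ε δ : ℝ), 0 ≤ β → β ≤ 1 / 18 → 0 ≤ ε → ε ≤ 1 → 0 ≤ δ → n * δ ≤ 1 / 20 →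
        ∀ M : Kernel (Fin n → EuclideanSpace ℝ (Fin d)) (Matrix (Fin d) (Fin d) ℝ),
          IsMarkovKernel M → IsDP ε δ M →
          expectedSqError (fun _ A => frobNorm A) D M ≤ ENNReal.ofReal (β ^ 2) →
          (d : ℝ) ^ 2 / 72 ≤ n * (β * ε) := by
    rcases hd.eq_or_lt with rfl | hd2
    · simpa using frobenius_bound_one
    · obtain ⟨k, l, hk, hl, rfl, hkl⟩ : ∃ k l : ℕ, 0 < k ∧ 0 < l ∧ d = k + l ∧
          (l = k ∨ l = k + 1) := ⟨d / 2, d - d / 2, by omega, by omega, by omega, by omega⟩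
      obtain ⟨D, hD, hae, hmain⟩ := frobenius_bound_add k l hk hl
      refine ⟨D, hD, hae, fun n β ε δ h1 h2 h3 h4 h5 h6 M hM hDP herr => ?_⟩
      refine le_trans ?_ (hmain n β ε δ h1 h2 h3 h4 h5 h6 M hM hDP herr)
      have hk1 : (1 : ℝ) ≤ k := by exact_mod_cast hk
      -- For a balanced split `(k + l) ^ 2 ≤ 8 * (k * l)`, which turns `k * l / 9` into `d ^ 2 /
      -- 72`.
      rcases hkl with rfl | rfl <;> push_cast <;> nlinarith
  obtain ⟨D, hD, hae, hmain⟩ := hcore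
  refine ⟨D, hD, hae, ?_⟩
  intro n α ε δ hα hα1 hε hε1 hδ _ hδn M hM hDP herr
  have hnδ : (n : ℝ) * δ ≤ 1 / 20 := by
    have h1 : δ ≤ 1 / 20 * (1 / (n : ℝ)) :=
      hδn.trans (mul_le_mul_of_nonneg_left (min_le_left _ _) (by norm_num))
    rcases Nat.eq_zero_or_pos n with rfl | hn
    · simp
    · have hn' : (0 : ℝ) < n := by exact_mod_cast hn
      calc (n : ℝ) * δ ≤ n * (1 / 20 * (1 / (n : ℝ))) := mul_le_mul_of_nonneg_left h1 hn'.le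
        _ = 1 / 20 := by field_simp
  have hfrob : expectedSqError (fun _ A => frobNorm A) D M ≤ ENNReal.ofReal ((2 * α) ^ 2) := by
    have h4 : ENNReal.ofReal ((2 * α) ^ 2) = 4 * ENNReal.ofReal (α ^ 2) := by
      rw [mul_pow, ENNReal.ofReal_mul (by norm_num)]; norm_num
    rcases herr with h | h
    · rw [h4]
      exact (expectedSqError_frobNorm_le hae M).trans (mul_le_mul_right h 4)
    · refine h.trans (ENNReal.ofReal_le_ofReal ?_)
      nlinarith [sq_nonneg α]
  have := hmain n (2 * α) ε δ (by linarith) (by linarith) hε hε1 hδ hnδ M hM hDP hfrob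
  linarith
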